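/- Let $W\subset\mathbb{C}$ be open and let $r=(x^1,\dots,x^4):W\to\mathbb{R}^4$ be a smooth immersion for which $z\in W$ is a conformal parameter, i.e. $\sum_{k=1}^4 (x^k_z)^2=0$, where $\partial=\partial_z$ and $\bar\partial=\partial_{\bar z}$ are the Wirtinger derivatives. All functions below are smooth. The Gauss map $G:W\to\mathbb{C}P^3$, $G=(x^1_z:\dots:x^4_z)$, takes values in the quadric $\{y_1^2+y_2^2+y_3^2+y_4^2=0\}$, which is identified with $\mathbb{C}P^1\times\mathbb{C}P^1$ by the Segre map sending $\big((a_1:a_2),(b_1:b_2)\big)$ to $$\left(\tfrac i2(a_2b_2+a_1b_1):\tfrac12(a_2b_2-a_1b_1):\tfrac12(a_2b_1+a_1b_2):\tfrac i2(a_2b_1-a_1b_2)\right).$$ Let $G_\varphi,G_\psi:W\to\mathbb{C}P^1$ be the components of $G$: $G$ is the image of $(G_\varphi,G_\psi)$, with $G_\varphi$ in the place of $(a_1:a_2)$ and $G_\psi$ in the place of $(b_1:b_2)$. A nowhere vanishing $\psi=(\psi_1,\psi_2):W\to\mathbb{C}^2$ represents $G_\psi$ if $G_\psi=(\psi_1:\bar\psi_2)$,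 and similarly a nowhere vanishing $\varphi=(\varphi_1,\varphi_2)$ represents $G_\varphi$ if $G_\varphi=(\varphi_1:\bar\varphi_2)$. For $U:W\to\mathbb{C}$ put $$\mathcal{D}=\begin{pmatrix}U&\partial\\-\bar\partial&\bar U\end{pmatrix},\qquad \mathcal{D}^\vee=\begin{pmatrix}\bar U&\partial\\-\bar\partial&U\end{pmatrix}.$$ A triple $(\psi,\varphi,U)$ is called a Dirac lift of $G$ if $\psi$ represents $G_\psi$, $\varphi$ represents $G_\varphi$, $\mathcal{D}\psi=0$, $\mathcal{D}^\vee\varphi=0$, and $$x^1_z=\tfrac i2(\bar\varphi_2\bar\psi_2+\varphi_1\psi_1),\quad x^2_z=\tfrac12(\bar\varphi_2\bar\psi_2-\varphi_1\psi_1),\quad x^3_z=\tfrac12(\bar\varphi_2\psi_1+\varphi_1\bar\psi_2),\quad x^4_z=\tfrac i2(\bar\varphi_2\psi_1-\varphi_1\bar\psi_2).\qquad(\ast)$$ **1.** Suppose that $G_\psi=(e^{i\theta}\cos\eta:\sin\eta)$ for smooth real functions $\theta,\eta$ on $W$, and for $g:W\to\mathbb{C}$ put $\psi_g=(e^{g+i\theta}\cos\eta,\;e^{\bar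 g}\sin\eta)$ and $U_g=-e^{\bar g-g-i\theta}(i\theta_z\sin\eta\cos\eta+\eta_z)$. (a) There is a $g$ on $W$ with $g_{\bar z}=-i\theta_{\bar z}\cos^2\eta$; for it, $\psi_g$ represents $G_\psi$, and $\mathcal{D}\psi_g=0$ with the smooth potential $U_g$. (b) For any $g$ and $U$, $\mathcal{D}\psi_g=0$ holds with potential $U$ if and only if $g_{\bar z}=-i\theta_{\bar z}\cos^2\eta$ and $U=U_g$. (c) If $g$ solves $g_{\bar z}=-i\theta_{\bar z}\cos^2\eta$, then $g'$ is a solution if and only if $h=g'-g$ is holomorphic; and $U_{g+h}=e^{\bar h-h}U_g$. (d) Any two Dirac lifts $(\psi_g,\varphi,U)$ and $(\psi_{g'},\varphi',U')$ are related as in $(\ast\ast)$ below by some holomorphic $h$ on $W$. **2.** If $\psi$ represents $G_\psi$ and $\mathcal{D}\psi=0$ with a potential $U$, then there is exactly one $\varphi$ satisfying $(\ast)$; it is smooth, represents $G_\varphi$ and satisfies $\mathcal{D}^\vee\varphi=0$ with the same $U$, so $(\psi,\varphi,U)$ is a Dirac lift. **3.** If $(\psi,\varphi,U)$ is a Dirac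 lift and $h$ is holomorphic on $W$, then so is $(\psi',\varphi',U')$ given by $$\psi'=(e^h\psi_1,e^{\bar h}\psi_2),\qquad\varphi'=(e^{-h}\varphi_1,e^{-\bar h}\varphi_2),\qquad U'=e^{\bar h-h}U.\qquad(\ast\ast)$$ If $W$ is simply connected (in particular, connected), then any two Dirac lifts of $G$ are related by $(\ast\ast)$ for some holomorphic $h$ on $W$. -/

import Mathlib

open scoped ContDiff ComplexConjugate

noncomputable section

namespace SurfaceR4

/-! Wirtinger derivatives of a complex valued function of `z = x + i y`. -/

/-- `∂f/∂z = (f_x - i f_y) / 2`. -/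
def dz (f : ℂ → ℂ) (z : ℂ) : ℂ :=
  (1 / 2 : ℂ) * (fderiv ℝ f z 1 - Complex.I * fderiv ℝ f z Complex.I)

/-- `∂f/∂z̄ = (f_x + i f_y) / 2`. -/
def dzbar (f : ℂ → ℂ) (z : ℂ) : ℂ :=
  (1 / 2 : ℂ) * (fderiv ℝ f z 1 + Complex.I * fderiv ℝ f z Complex.I)

/-! Dirac operators. A spinor field is a function `ψ = (ψ₁, ψ₂)`, here `(ψ z 0, ψ z 1)`. -/

/-- The operator `𝒟 = ((0, ∂), (-∂̄, 0)) + ((U, 0), (0, Ū))` applied to `ψ`. -/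
def dirac (U : ℂ → ℂ) (ψ : ℂ → Fin 2 → ℂ) (z : ℂ) : Fin 2 → ℂ :=
  ![dz (fun w => ψ w 1) z + U z * ψ z 0,
    -dzbar (fun w => ψ w 0) z + conj (U z) * ψ z 1]

/-- The operator `𝒟^∨ = ((0, ∂), (-∂̄, 0)) + ((Ū, 0), (0, U))` applied to `φ`. -/
def diracDual (U : ℂ → ℂ) (φ : ℂ → Fin 2 → ℂ) (z : ℂ) : Fin 2 → ℂ :=
  ![dz (fun w => φ w 1) z + conj (U z) * φ z 0,
    -dzbar (fun w => φ w 0) z + U z * φ z 1]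

/-! Conformal immersions and the Gauss map. -/

/-- The vector `r_z = (x¹_z, …, x⁴_z) ∈ ℂ⁴`. -/
def rz (r : ℂ → EuclideanSpace ℝ (Fin 4)) (z : ℂ) : Fin 4 → ℂ :=
  fun k => dz (fun w => ((r w k : ℝ) : ℂ)) z

/-- `r` is a smooth immersion of `W` into `ℝ⁴` and `z` is a conformal parameter:
`⟨r_z, r_z⟩ = 0`, for the complex bilinear extension of the inner product. -/
structure IsConformalImmersionOn (r : ℂ → EuclideanSpace ℝ (Fin 4)) (W : Set ℂ) : Prop where
  isOpen : IsOpen W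
  smooth : ContDiffOn ℝ ∞ r W
  immersion : ∀ z ∈ W, Function.Injective (fderiv ℝ r z)
  conformal : ∀ z ∈ W, ∑ k, rz r z k ^ 2 = 0

theorem IsConformalImmersionOn.rz_ne_zero {r : ℂ → EuclideanSpace ℝ (Fin 4)} {W : Set ℂ}
    (hr : IsConformalImmersionOn r W) {z : ℂ} (hz : z ∈ W) : rz r z ≠ 0 := by
  intro h0
  have hd : DifferentiableAt ℝ r z :=
    (hr.smooth.contDiffAt (hr.isOpen.mem_nhds hz)).differentiableAt (by simp)
  have key : fderiv ℝ r z 1 = 0 := by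
    ext k
    have hk : HasFDerivAt (fun w => r w k)
        ((EuclideanSpace.proj k : EuclideanSpace ℝ (Fin 4) →L[ℝ] ℝ).comp (fderiv ℝ r z)) z :=
      (EuclideanSpace.proj k : EuclideanSpace ℝ (Fin 4) →L[ℝ] ℝ).hasFDerivAt.comp z
        hd.hasFDerivAt
    have hc : HasFDerivAt (fun w => ((r w k : ℝ) : ℂ)) _ z :=
      Complex.ofRealCLM.hasFDerivAt.comp z hk
    have h := congrFun h0 k
    simp only [rz, dz, hc.fderiv] at h
    have h' := congrArg Complex.re h
    simpa using h'
  exact one_ne_zero (hr.immersion z hz (key.trans (map_zero _).symm))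

/-- The Gauss map `z ↦ (x¹_z : … : x⁴_z) ∈ ℂP³`. Its values lie on the quadric
`y₁² + y₂² + y₃² + y₄² = 0`, the Grassmannian of oriented two-planes in `ℝ⁴`. -/
def gaussMap {r : ℂ → EuclideanSpace ℝ (Fin 4)} {W : Set ℂ}
    (hr : IsConformalImmersionOn r W) (z : W) : Projectivization ℂ (Fin 4 → ℂ) :=
  Projectivization.mk ℂ (rz r z) (hr.rz_ne_zero z.2)

/-! The Segre map onto the quadric. -/

/-- The Segre map in homogeneous coordinates: `y'₁ = a₂b₂`, `y'₂ = a₁b₁`, `y'₃ = a₂b₁`,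
`y'₄ = a₁b₂`, and `y₁ = i(y'₁ + y'₂)/2`, `y₂ = (y'₁ - y'₂)/2`, `y₃ = (y'₃ + y'₄)/2`,
`y₄ = i(y'₃ - y'₄)/2`. -/
def segreVec (a b : Fin 2 → ℂ) : Fin 4 → ℂ :=
  ![Complex.I / 2 * (a 1 * b 1 + a 0 * b 0),
    1 / 2 * (a 1 * b 1 - a 0 * b 0),
    1 / 2 * (a 1 * b 0 + a 0 * b 1),
    Complex.I / 2 * (a 1 * b 0 - a 0 * b 1)]

theorem segreVec_ne_zero {a b : Fin 2 → ℂ} (ha : a ≠ 0) (hb : b ≠ 0) : segreVec a b ≠ 0 := by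
  intro h
  have h0 := congrFun h 0
  have h1 := congrFun h 1
  have h2 := congrFun h 2
  have h3 := congrFun h 3
  simp [segreVec, Complex.I_ne_zero] at h0 h1 h2 h3
  have e11 : a 1 * b 1 = 0 := by linear_combination (h0 + h1) / 2
  have e00 : a 0 * b 0 = 0 := by linear_combination (h0 - h1) / 2
  have e10 : a 1 * b 0 = 0 := by linear_combination (h2 + h3) / 2
  have e01 : a 0 * b 1 = 0 := by linear_combination (h2 - h3) / 2
  apply hb
  by_cases ha0 : a 0 = 0
  · have ha1 : a 1 ≠ 0 := by
      intro ha1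
      exact ha (by ext i; fin_cases i <;> simp [ha0, ha1])
    ext i
    fin_cases i
    · simpa [ha1] using e10
    · simpa [ha1] using e11
  · ext i
    fin_cases i
    · simpa [ha0] using e00
    · simpa [ha0] using e01

/-- The Segre map `ℂP¹ × ℂP¹ → ℂP³`, a bijection onto the quadric. -/
def segre (a b : Projectivization ℂ (Fin 2 → ℂ)) : Projectivization ℂ (Fin 4 → ℂ) :=
  Projectivization.mk ℂ (segreVec a.rep b.rep) (segreVec_ne_zero a.rep_nonzero b.rep_nonzero)

theorem segre_mk (a b : Fin 2 → ℂ) (ha : a ≠ 0) (hb : b ≠ 0) :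
    segre (Projectivization.mk ℂ a ha) (Projectivization.mk ℂ b hb) =
      Projectivization.mk ℂ (segreVec a b) (segreVec_ne_zero ha hb) := by
  obtain ⟨s, hs⟩ := Projectivization.exists_smul_eq_mk_rep ℂ a ha
  obtain ⟨t, ht⟩ := Projectivization.exists_smul_eq_mk_rep ℂ b hb
  rw [segre, Projectivization.mk_eq_mk_iff']
  refine ⟨(s : ℂ) * t, ?_⟩
  rw [← hs, ← ht]
  ext i
  fin_cases i <;> simp [segreVec, Units.smul_def] <;> ring

/-- `G = (G_ψ, G_φ)`: the two maps are the components of the Gauss map of `r` under the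
Segre equivalence. -/
def AreGaussComponents {r : ℂ → EuclideanSpace ℝ (Fin 4)} {W : Set ℂ}
    (hr : IsConformalImmersionOn r W) (Gψ Gφ : W → Projectivization ℂ (Fin 2 → ℂ)) : Prop :=
  ∀ z : W, segre (Gφ z) (Gψ z) = gaussMap hr z

/-! Lifts. -/

/-- The vector `(χ₁, χ̄₂)` attached to a spinor `χ = (χ₁, χ₂)`. -/
def halfConj (χ : Fin 2 → ℂ) : Fin 2 → ℂ := ![χ 0, conj (χ 1)]

/-- The spinor field `χ` does not vanish on `W` and represents `G`: `G = (χ₁ : χ̄₂)`. -/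
def Represents {W : Set ℂ} (χ : ℂ → Fin 2 → ℂ) (G : W → Projectivization ℂ (Fin 2 → ℂ)) :
    Prop :=
  ∀ z : W, ∃ h : halfConj (χ z) ≠ 0, G z = Projectivization.mk ℂ (halfConj (χ z)) h

/-- The Weierstrass formulas for `r_z`:
`x¹_z = i(φ̄₂ψ̄₂ + φ₁ψ₁)/2`, `x²_z = (φ̄₂ψ̄₂ - φ₁ψ₁)/2`,
`x³_z = (φ̄₂ψ₁ + φ₁ψ̄₂)/2`, `x⁴_z = i(φ̄₂ψ₁ - φ₁ψ̄₂)/2`. -/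
def WeierstrassFormula (r : ℂ → EuclideanSpace ℝ (Fin 4)) (W : Set ℂ)
    (ψ φ : ℂ → Fin 2 → ℂ) : Prop :=
  ∀ z ∈ W, rz r z = segreVec (halfConj (φ z)) (halfConj (ψ z))

/-- `(ψ, φ)` is a smooth lift of `(G_ψ, G_φ)` to nonvanishing spinors which gives `r_z` by the
Weierstrass formulas and satisfies the Dirac equations with the potential `U`. -/
structure IsDiracLift (r : ℂ → EuclideanSpace ℝ (Fin 4)) {W : Set ℂ}
    (Gψ Gφ : W → Projectivization ℂ (Fin 2 → ℂ)) (ψ φ : ℂ → Fin 2 → ℂ) (U : ℂ → ℂ) :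
    Prop where
  smooth_psi : ContDiffOn ℝ ∞ ψ W
  smooth_phi : ContDiffOn ℝ ∞ φ W
  represents_psi : Represents ψ Gψ
  represents_phi : Represents φ Gφ
  weierstrass : WeierstrassFormula r W ψ φ
  dirac_psi : ∀ z ∈ W, dirac U ψ z = 0
  dirac_phi : ∀ z ∈ W, diracDual U φ z = 0

/-- The second triple is obtained from the first one on `W` by the gauge transformation
`ψ' = (e^h ψ₁, e^{h̄} ψ₂)`, `φ' = (e^{-h} φ₁, e^{-h̄} φ₂)`, `U' = e^{h̄ - h} U`. -/
def GaugeRelated (W : Set ℂ) (h : ℂ → ℂ) (ψ φ : ℂ → Fin 2 → ℂ) (U : ℂ → ℂ)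
    (ψ' φ' : ℂ → Fin 2 → ℂ) (U' : ℂ → ℂ) : Prop :=
  ∀ z ∈ W,
    ψ' z = ![Complex.exp (h z) * ψ z 0, Complex.exp (conj (h z)) * ψ z 1] ∧
    φ' z = ![Complex.exp (-h z) * φ z 0, Complex.exp (-conj (h z)) * φ z 1] ∧
    U' z = Complex.exp (conj (h z) - h z) * U z

/-! The lift in spherical coordinates. -/

/-- The vector `(e^{iθ} cos η, sin η)`. -/
def sphericalVec (θ η : ℝ) : Fin 2 → ℂ :=
  ![Complex.exp (Complex.I * θ) * Real.cos η, Real.sin η]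

theorem sphericalVec_ne_zero (θ η : ℝ) : sphericalVec θ η ≠ 0 := by
  intro h
  have h0 := congrFun h 0
  have h1 := congrFun h 1
  simp only [sphericalVec, Matrix.cons_val_zero, Matrix.cons_val_one, Pi.zero_apply,
    mul_eq_zero, Complex.exp_ne_zero, false_or, Complex.ofReal_eq_zero] at h0 h1
  have := Real.sin_sq_add_cos_sq η
  simp [h0, h1] at this

/-- The point `(e^{iθ} cos η : sin η)` of `ℂP¹`. -/
def sphericalPoint (θ η : ℝ) : Projectivization ℂ (Fin 2 → ℂ) :=
  Projectivization.mk ℂ (sphericalVec θ η) (sphericalVec_ne_zero θ η)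

/-- The spinor field `(e^{g+iθ} cos η, e^{ḡ} sin η)`. -/
def liftOf (θ η : ℂ → ℝ) (g : ℂ → ℂ) (z : ℂ) : Fin 2 → ℂ :=
  ![Complex.exp (g z + Complex.I * θ z) * Real.cos (η z),
    Complex.exp (conj (g z)) * Real.sin (η z)]

/-- The equation `g_z̄ = -i θ_z̄ cos² η` on `W`. -/
def SolvesDbar (W : Set ℂ) (θ η : ℂ → ℝ) (g : ℂ → ℂ) : Prop :=
  ∀ z ∈ W, dzbar g z =
    -Complex.I * dzbar (fun w => ((θ w : ℝ) : ℂ)) z * (Real.cos (η z) : ℂ) ^ 2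

/-- The potential `-e^{ḡ - g - iθ} (i θ_z sin η cos η + η_z)`. -/
def potentialOf (θ η : ℂ → ℝ) (g : ℂ → ℂ) (z : ℂ) : ℂ :=
  -Complex.exp (conj (g z) - g z - Complex.I * θ z) *
    (Complex.I * dz (fun w => ((θ w : ℝ) : ℂ)) z * Real.sin (η z) * Real.cos (η z) +
      dz (fun w => ((η w : ℝ) : ℂ)) z)

end SurfaceR4

end

open SurfaceR4

/-
Writing `b = (ψ₁, ψ̄₂)`, the Dirac equation `𝒟ψ = 0` becomes `b_z̄ = Ū j b`, where `j` is the
quaternionic structure of `ℂ²`. Since `b` and `j b` are independent, a multiple `l b` solves the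
equation with some potential exactly when `l` solves a scalar equation `l_z̄ + α l = 0`; for
`l = e^g` and `b = (e^{iθ} cos η, sin η)` this is a `∂̄`-equation for `g`.

The `∂̄`-equation is solvable on every open set: a partition of unity splits the right-hand side
into pieces supported in small discs, and conjugating the Cauchy transform by a high power of
`(z - p)⁻¹`, with `p` outside the set, or of `z` makes the solution for a piece small on a given
compact set once its disc is far enough out, so that the series of these solutions converges.

The formulas (∗) determine `φ`, and the dual equation for `φ` holds because `r_zz̄` is real and a
real vector on the quadric vanishes.
-/

namespace SurfaceR4

section Wirtinger

variable {f g : ℂ → ℂ} {z : ℂ} {W : Set ℂ}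

theorem dzbar_congr (h : f =ᶠ[nhds z] g) : dzbar f z = dzbar g z := by
  simp only [dzbar, h.fderiv_eq]

theorem dzbar_add (hf : DifferentiableAt ℝ f z) (hg : DifferentiableAt ℝ g z) :
    dzbar (fun w => f w + g w) z = dzbar f z + dzbar g z := by
  simp only [dzbar, fderiv_fun_add hf hg, add_apply]
  ring

theorem dzbar_sub (hf : DifferentiableAt ℝ f z) (hg : DifferentiableAt ℝ g z) :
    dzbar (fun w => f w - g w) z = dzbar f z - dzbar g z := by
  simp only [dzbar, fderiv_fun_sub hf hg, sub_apply]
  ring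

theorem dzbar_sum {ι : Type*} {s : Finset ι} {F : ι → ℂ → ℂ}
    (hF : ∀ i ∈ s, DifferentiableAt ℝ (F i) z) :
    dzbar (fun w => ∑ i ∈ s, F i w) z = ∑ i ∈ s, dzbar (F i) z := by
  simp only [dzbar, fderiv_fun_sum hF, sum_apply, Finset.mul_sum, ← Finset.sum_add_distrib]

theorem dzbar_mul (hf : DifferentiableAt ℝ f z) (hg : DifferentiableAt ℝ g z) :
    dzbar (fun w => f w * g w) z = dzbar f z * g z + f z * dzbar g z := by
  simp only [dzbar, fderiv_fun_mul hf hg, add_apply, smul_apply, smul_eq_mul]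
  ring

theorem dzbar_const_mul (c : ℂ) (hf : DifferentiableAt ℝ f z) :
    dzbar (fun w => c * f w) z = c * dzbar f z := by
  simp only [dzbar, fderiv_const_mul hf, smul_apply, smul_eq_mul]
  ring

theorem fderiv_conj_comp (f : ℂ → ℂ) (z v : ℂ) :
    fderiv ℝ (fun w => conj (f w)) z v = conj (fderiv ℝ f z v) :=
  congrArg (· v) (Complex.conjCLE.comp_fderiv (f := f) (x := z))

theorem dz_conj (f : ℂ → ℂ) (z : ℂ) : dz (fun w => conj (f w)) z = conj (dzbar f z) := by
  simp only [dz, dzbar, fderiv_conj_comp, map_mul, map_add, Complex.conj_I, map_div₀, map_one,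
    map_ofNat]
  ring

theorem dzbar_conj (f : ℂ → ℂ) (z : ℂ) : dzbar (fun w => conj (f w)) z = conj (dz f z) := by
  simp only [dz, dzbar, fderiv_conj_comp, map_mul, map_sub, Complex.conj_I, map_div₀, map_one,
    map_ofNat]
  ring

theorem conj_dz_ofReal (x : ℂ → ℝ) (z : ℂ) :
    conj (dz (fun w => (x w : ℂ)) z) = dzbar (fun w => (x w : ℂ)) z := by
  simp only [← dzbar_conj, Complex.conj_ofReal]

theorem dzbar_comp {F : ℂ → ℂ} {F' : ℂ} (hF : HasDerivAt F F' (f z))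
    (hf : DifferentiableAt ℝ f z) : dzbar (fun w => F (f w)) z = F' * dzbar f z := by
  have h : fderiv ℝ (fun w => F (f w)) z = _ :=
    ((hF.hasFDerivAt.restrictScalars ℝ).comp z hf.hasFDerivAt).fderiv
  simp only [dzbar, h, ContinuousLinearMap.comp_apply, ContinuousLinearMap.coe_restrictScalars',
    ContinuousLinearMap.toSpanSingleton_apply, smul_eq_mul]
  ring

theorem differentiableAt_complex_iff_dzbar_eq_zero :
    DifferentiableAt ℂ f z ↔ DifferentiableAt ℝ f z ∧ dzbar f z = 0 := by
  rw [differentiableAt_complex_iff_differentiableAt_real]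
  refine and_congr_right fun _ => ⟨fun h => ?_, fun h => ?_⟩
  · rw [dzbar, h, smul_eq_mul]
    linear_combination (1 / 2 : ℂ) * fderiv ℝ f z 1 * Complex.I_mul_I
  · rw [dzbar] at h
    rw [smul_eq_mul]
    linear_combination (-2 * Complex.I) * h + fderiv ℝ f z Complex.I * Complex.I_mul_I

theorem dzbar_eq_zero_of_differentiableOn (hW : IsOpen W) (hf : DifferentiableOn ℂ f W)
    (hz : z ∈ W) : dzbar f z = 0 :=
  (differentiableAt_complex_iff_dzbar_eq_zero.1 (hf.differentiableAt (hW.mem_nhds hz))).2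

theorem contDiffOn_real_of_differentiableOn (hW : IsOpen W) (hf : DifferentiableOn ℂ f W) :
    ContDiffOn ℝ ∞ f W :=
  (hf.contDiffOn hW).restrict_scalars ℝ

theorem differentiableAt_of_contDiffOn {E : Type*} [NormedAddCommGroup E] [NormedSpace ℝ E]
    {f : ℂ → E} (hW : IsOpen W) (hf : ContDiffOn ℝ ∞ f W) (hz : z ∈ W) :
    DifferentiableAt ℝ f z :=
  (hf.contDiffAt (hW.mem_nhds hz)).differentiableAt (by simp)

theorem contDiffOn_fderiv_apply (hW : IsOpen W) (hf : ContDiffOn ℝ ∞ f W) (v : ℂ) :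
    ContDiffOn ℝ ∞ (fun z => fderiv ℝ f z v) W :=
  (hf.fderiv_of_isOpen hW (by simp)).clm_apply contDiffOn_const

theorem contDiffOn_dz (hW : IsOpen W) (hf : ContDiffOn ℝ ∞ f W) : ContDiffOn ℝ ∞ (dz f) W :=
  contDiffOn_const.mul ((contDiffOn_fderiv_apply hW hf 1).sub
    (contDiffOn_const.mul (contDiffOn_fderiv_apply hW hf Complex.I)))

theorem contDiffOn_dzbar (hW : IsOpen W) (hf : ContDiffOn ℝ ∞ f W) :
    ContDiffOn ℝ ∞ (dzbar f) W :=
  contDiffOn_const.mul ((contDiffOn_fderiv_apply hW hf 1).add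
    (contDiffOn_const.mul (contDiffOn_fderiv_apply hW hf Complex.I)))

theorem dz_dzbar_comm (hf : ContDiffAt ℝ 2 f z) : dz (dzbar f) z = dzbar (dz f) z := by
  have hd : DifferentiableAt ℝ (fderiv ℝ f) z :=
    (hf.fderiv_right (m := 1) le_rfl).differentiableAt one_ne_zero
  have hv (v : ℂ) :
      HasFDerivAt (fun w => fderiv ℝ f w v) ((fderiv ℝ (fderiv ℝ f) z).flip v) z := by
    simpa using hd.hasFDerivAt.clm_apply (hasFDerivAt_const v z)
  have hs : fderiv ℝ (fderiv ℝ f) z 1 Complex.I = fderiv ℝ (fderiv ℝ f) z Complex.I 1 :=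
    (hf.isSymmSndFDerivAt (by simp)).eq 1 Complex.I
  have h1 : HasFDerivAt (dz f) _ z :=
    ((hv 1).sub ((hv Complex.I).const_mul Complex.I)).const_mul _
  have h2 : HasFDerivAt (dzbar f) _ z :=
    ((hv 1).add ((hv Complex.I).const_mul Complex.I)).const_mul _
  rw [dz, dzbar, h1.fderiv, h2.fderiv]
  simp only [smul_apply, add_apply, sub_apply, ContinuousLinearMap.flip_apply, smul_eq_mul, hs]
  ring

theorem conj_dzbar_dz_ofReal {x : ℂ → ℝ} (hx : ContDiffAt ℝ 2 x z) :
    conj (dzbar (dz fun w => (x w : ℂ)) z) = dzbar (dz fun w => (x w : ℂ)) z := by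
  have hc : ContDiffAt ℝ 2 (fun w => (x w : ℂ)) z :=
    Complex.ofRealCLM.contDiff.contDiffAt.comp z hx
  rw [← dz_conj, ← dz_dzbar_comm hc]
  simp only [conj_dz_ofReal]

end Wirtinger

section CauchyTransform

open MeasureTheory Set Filter Topology

theorem locallyIntegrable_inv : LocallyIntegrable (fun w : ℂ => w⁻¹) :=
  locallyIntegrable_of_norm_le_rpow (C := 1) (α := 1) (by simp) (by simp)
    (.of_forall fun w => by simp [Real.rpow_neg_one])
    (by fun_prop : Measurable fun w : ℂ => w⁻¹).aestronglyMeasurable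

theorem conj_mul_dzbar (f : ℂ → ℂ) (z u : ℂ) : conj u * dzbar f z =
    1 / 2 * (fderiv ℝ f z u + Complex.I * fderiv ℝ f z (Complex.I * u)) := by
  have hlin (a b : ℝ) : fderiv ℝ f z (a + b * Complex.I) =
      a * fderiv ℝ f z 1 + b * fderiv ℝ f z Complex.I := by
    rw [← Complex.real_smul (z := Complex.I), map_add, map_smul, ← mul_one (a : ℂ),
      ← Complex.real_smul (z := 1), map_smul, Complex.real_smul, Complex.real_smul]
    simp
  have hu : conj u = u.re - u.im * Complex.I := Complex.ext (by simp) (by simp)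
  have hIu : Complex.I * u = (-u.im : ℝ) + u.re * Complex.I := Complex.ext (by simp) (by simp)
  rw [hIu, hlin, ← Complex.re_add_im u, hlin, Complex.re_add_im, hu, dzbar]
  push_cast
  linear_combination -(1 / 2 : ℂ) * u.im * fderiv ℝ f z Complex.I * Complex.I_mul_I

theorem integral_Ioi_fderiv_ofReal_mul {G : ℂ → ℂ} (hG : ContDiff ℝ 1 G)
    (hc : HasCompactSupport G) {u : ℂ} (hu : u ≠ 0) :
    ∫ s in Ioi (0 : ℝ), fderiv ℝ G (s * u) u = -G 0 := by
  have hd (s : ℝ) : deriv (fun s : ℝ => G (s • u)) s = fderiv ℝ G (s * u) u := by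
    have h := ((hG.differentiable one_ne_zero (s • u)).hasFDerivAt.comp_hasDerivAt s
      ((hasDerivAt_id s).smul_const u)).deriv
    simpa only [Function.comp_def, id, one_smul, Complex.real_smul] using h
  have h := HasCompactSupport.integral_Ioi_deriv_eq
    (hG.comp (g := G) (f := fun s : ℝ => s • u) (contDiff_id.smul contDiff_const))
    (hc.comp_isClosedEmbedding (isClosedEmbedding_smul_left hu)) 0
  simpa only [Function.comp_def, id, hd, zero_smul] using h

theorem integral_Ioo_fderiv_mul_exp {G : ℂ → ℂ} (hG : ContDiff ℝ 1 G) {s : ℝ} (hs : s ≠ 0) :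
    ∫ t in Ioo (-Real.pi) Real.pi, fderiv ℝ G (s * Complex.exp (t * Complex.I))
      (Complex.I * Complex.exp (t * Complex.I)) = 0 := by
  have hd (t : ℝ) : HasDerivAt (fun t => G (circleMap 0 s t))
      (s • fderiv ℝ G (s * Complex.exp (t * Complex.I))
        (Complex.I * Complex.exp (t * Complex.I))) t := by
    have h := (hG.differentiable one_ne_zero _).hasFDerivAt.comp_hasDerivAt t
      (hasDerivAt_circleMap 0 s t)
    rw [← map_smul, Complex.real_smul, mul_left_comm, ← circleMap_zero, mul_comm Complex.I]
    exact h
  have hcont : Continuous fun t : ℝ => s • fderiv ℝ G (s * Complex.exp (t * Complex.I))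
      (Complex.I * Complex.exp (t * Complex.I)) := by
    have := hG.continuous_fderiv one_ne_zero
    fun_prop
  have hper : circleMap 0 s Real.pi = circleMap 0 s (-Real.pi) := by
    simpa [two_mul] using periodic_circleMap 0 s (-Real.pi)
  have h := intervalIntegral.integral_eq_sub_of_hasDerivAt (fun t _ => hd t)
    (hcont.intervalIntegrable (-Real.pi) Real.pi)
  rw [hper, sub_self, intervalIntegral.integral_smul, smul_eq_zero_iff_right hs,
    intervalIntegral.integral_of_le (by linarith [Real.pi_pos]),
    integral_Ioc_eq_integral_Ioo] at h
  exact h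

theorem integrableOn_polarCoord_target {E : Type*} [NormedAddCommGroup E] {F : ℝ × ℝ → E}
    (hF : Continuous F) {R : ℝ} (hR : ∀ p : ℝ × ℝ, R < p.1 → F p = 0) :
    IntegrableOn F polarCoord.target := by
  have hK : IntegrableOn F (Icc 0 R ×ˢ Icc (-Real.pi) Real.pi) :=
    hF.continuousOn.integrableOn_compact (isCompact_Icc.prod isCompact_Icc)
  refine hK.of_forall_sdiff_eq_zero polarCoord.open_target.measurableSet fun p hp => hR p ?_
  obtain ⟨⟨hp1, hp2⟩, hpK⟩ := hp
  by_contra! h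
  exact hpK ⟨⟨le_of_lt hp1, h⟩, Ioo_subset_Icc_self hp2⟩

theorem integrableOn_fderiv_mul_exp {G : ℂ → ℂ} (hG : ContDiff ℝ 1 G) (hc : HasCompactSupport G)
    (c : ℂ) : IntegrableOn (fun p : ℝ × ℝ => fderiv ℝ G (p.1 * Complex.exp (p.2 * Complex.I))
      (c * Complex.exp (p.2 * Complex.I))) polarCoord.target := by
  have := hG.continuous_fderiv one_ne_zero
  obtain ⟨R, hR⟩ := (hc.fderiv ℝ).isCompact.isBounded.exists_norm_le
  refine integrableOn_polarCoord_target (by fun_prop) (R := R) fun p hp => ?_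
  have hp' : (p.1 * Complex.exp (p.2 * Complex.I) : ℂ) ∉ tsupport (fderiv ℝ G) := fun h => by
    have hp1 := hR _ h
    rw [norm_mul, Complex.norm_exp_ofReal_mul_I, mul_one, Complex.norm_real] at hp1
    exact absurd (hp1.trans_lt hp) (not_lt.2 (le_abs_self _))
  rw [image_eq_zero_of_notMem_tsupport hp', zero_apply]

/- In polar coordinates `∂̄` is a combination of the radial and the angular derivative; the first
integrates to `-G 0` on every ray and the second to `0` on every circle. -/
theorem integral_inv_mul_dzbar {G : ℂ → ℂ} (hG : ContDiff ℝ 1 G) (hc : HasCompactSupport G) :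
    ∫ w, w⁻¹ * dzbar G w = -(Real.pi * G 0) := by
  have hA := integrableOn_fderiv_mul_exp hG hc 1
  have hB := integrableOn_fderiv_mul_exp hG hc Complex.I
  have hradial : ∫ p in polarCoord.target, fderiv ℝ G (p.1 * Complex.exp (p.2 * Complex.I))
      (1 * Complex.exp (p.2 * Complex.I)) = -(2 * Real.pi * G 0) := by
    rw [polarCoord_target, Measure.volume_eq_prod] at hA ⊢
    rw [← Measure.prod_restrict, integral_prod_symm _ (by rwa [Measure.prod_restrict])]
    simp only [one_mul, integral_Ioi_fderiv_ofReal_mul hG hc (Complex.exp_ne_zero _),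
      setIntegral_const]
    rw [Real.volume_real_Ioo_of_le (by linarith [Real.pi_pos]), Complex.real_smul]
    push_cast
    ring
  have hangular : ∫ p in polarCoord.target, fderiv ℝ G (p.1 * Complex.exp (p.2 * Complex.I))
      (Complex.I * Complex.exp (p.2 * Complex.I)) = 0 := by
    rw [polarCoord_target, Measure.volume_eq_prod] at hB ⊢
    rw [setIntegral_prod _ hB]
    exact setIntegral_eq_zero_of_forall_eq_zero fun s hs =>
      integral_Ioo_fderiv_mul_exp hG (ne_of_gt hs)
  have hpolar (p : ℝ × ℝ) (hp : p ∈ polarCoord.target) :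
      p.1 • ((Complex.polarCoord.symm p)⁻¹ * dzbar G (Complex.polarCoord.symm p)) =
        1 / 2 * (fderiv ℝ G (p.1 * Complex.exp (p.2 * Complex.I))
          (1 * Complex.exp (p.2 * Complex.I)) +
        Complex.I * fderiv ℝ G (p.1 * Complex.exp (p.2 * Complex.I))
          (Complex.I * Complex.exp (p.2 * Complex.I))) := by
    have hp0 : (p.1 : ℂ) ≠ 0 := Complex.ofReal_ne_zero.2 (ne_of_gt hp.1)
    rw [one_mul, ← conj_mul_dzbar, Complex.polarCoord_symm_apply, Complex.ofReal_cos,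
      Complex.ofReal_sin, ← Complex.exp_mul_I, Complex.real_smul, mul_inv, mul_assoc _⁻¹,
      mul_inv_cancel_left₀ hp0, Complex.inv_eq_conj (Complex.norm_exp_ofReal_mul_I _)]
  rw [← Complex.integral_comp_polarCoord_symm,
    setIntegral_congr_fun polarCoord.open_target.measurableSet hpolar, integral_const_mul,
    integral_add hA (hB.const_mul _), integral_const_mul, hradial, hangular]
  ring

/-- The Cauchy transform `(1/π) ∫ g(ζ) / (z - ζ) dA(ζ)`, written as the convolution of `g` with the
fundamental solution `1 / (π w)` of `∂̄`. -/
noncomputable def cauchyTransform (g : ℂ → ℂ) (z : ℂ) : ℂ :=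
  (Real.pi : ℂ)⁻¹ * ∫ w, w⁻¹ * g (z - w)

theorem contDiff_cauchyTransform {n : ℕ∞} {g : ℂ → ℂ} (hg : ContDiff ℝ n g)
    (hc : HasCompactSupport g) : ContDiff ℝ n (cauchyTransform g) :=
  contDiff_const.mul
    (hc.contDiff_convolution_right (ContinuousLinearMap.mul ℝ ℂ) locallyIntegrable_inv hg)

theorem dzbar_cauchyTransform_eq_cauchyTransform_dzbar {g : ℂ → ℂ} (hg : ContDiff ℝ 1 g)
    (hc : HasCompactSupport g) (z : ℂ) :
    dzbar (cauchyTransform g) z = cauchyTransform (dzbar g) z := by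
  have hint := (hc.fderiv ℝ).convolutionExists_right ((ContinuousLinearMap.mul ℝ ℂ).precompR ℂ)
    locallyIntegrable_inv (hg.continuous_fderiv one_ne_zero) z
  have hi (v : ℂ) : Integrable fun w => w⁻¹ * fderiv ℝ g (z - w) v := by
    simpa using hint.apply_continuousLinearMap v
  have hd (v : ℂ) : fderiv ℝ (cauchyTransform g) z v =
      (Real.pi : ℂ)⁻¹ * ∫ w, w⁻¹ * fderiv ℝ g (z - w) v := by
    have h : HasFDerivAt (cauchyTransform g) _ z := (hc.hasFDerivAt_convolution_right
      (ContinuousLinearMap.mul ℝ ℂ) locallyIntegrable_inv hg z).const_mul (Real.pi : ℂ)⁻¹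
    rw [h.fderiv, smul_apply, smul_eq_mul, convolution_def,
      ContinuousLinearMap.integral_apply hint]
    simp
  rw [dzbar, hd, hd, cauchyTransform, mul_left_comm Complex.I, ← mul_add, ← integral_const_mul,
    ← integral_add (hi 1) ((hi _).const_mul _), mul_left_comm, ← integral_const_mul]
  congr with w
  rw [dzbar]
  ring

theorem dzbar_cauchyTransform {g : ℂ → ℂ} (hg : ContDiff ℝ 1 g) (hc : HasCompactSupport g)
    (z : ℂ) : dzbar (cauchyTransform g) z = g z := by
  have hd (w : ℂ) : dzbar (fun w => g (z - w)) w = -dzbar g (z - w) := by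
    have h : fderiv ℝ (fun w => g (z - w)) w = _ :=
      ((hg.differentiable one_ne_zero (z - w)).hasFDerivAt.comp w
        ((hasFDerivAt_id (𝕜 := ℝ) w).const_sub z)).fderiv
    simp only [dzbar, h, ContinuousLinearMap.comp_apply, neg_apply,
      ContinuousLinearMap.id_apply, map_neg]
    ring
  have h := integral_inv_mul_dzbar (G := fun w => g (z - w)) (by fun_prop)
    (hc.comp_homeomorph (Homeomorph.subLeft z))
  simp only [hd, mul_neg, integral_neg, neg_inj, sub_zero] at h
  rw [dzbar_cauchyTransform_eq_cauchyTransform_dzbar hg hc, cauchyTransform, h,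
    inv_mul_cancel_left₀ (Complex.ofReal_ne_zero.2 Real.pi_ne_zero)]

theorem norm_cauchyTransform_le {g : ℂ → ℂ} {c z : ℂ} {ρ δ S : ℝ} (hρ : 0 ≤ ρ) (hδ : 0 < δ)
    (hsupp : ∀ ζ ∉ Metric.closedBall c ρ, g ζ = 0) (hS : ∀ ζ, ‖g ζ‖ ≤ S)
    (hz : ρ + δ ≤ dist z c) : ‖cauchyTransform g z‖ ≤ S * ρ ^ 2 / δ := by
  have hset : ∫ w, w⁻¹ * g (z - w) = ∫ w in Metric.closedBall (z - c) ρ, w⁻¹ * g (z - w) := by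
    refine (setIntegral_eq_integral_of_forall_compl_eq_zero fun w hw => ?_).symm
    rw [hsupp _ fun h => hw ?_, mul_zero]
    rwa [Metric.mem_closedBall, dist_comm, dist_eq_norm, sub_right_comm, ← dist_eq_norm]
  have hvol : volume.real (Metric.closedBall (z - c) ρ) = Real.pi * ρ ^ 2 := by
    rw [Measure.real, Complex.volume_closedBall]
    simp [ENNReal.toReal_ofReal hρ, mul_comm]
  have hle : ‖∫ w in Metric.closedBall (z - c) ρ, w⁻¹ * g (z - w)‖ ≤
      δ⁻¹ * S * (Real.pi * ρ ^ 2) := by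
    rw [← hvol]
    refine norm_setIntegral_le_of_norm_le_const measure_closedBall_lt_top fun w hw => ?_
    rw [norm_mul, norm_inv]
    refine mul_le_mul (inv_anti₀ hδ ?_) (hS _) (norm_nonneg _) (by positivity)
    rw [Metric.mem_closedBall', dist_eq_norm] at hw
    rw [dist_eq_norm] at hz
    linarith [norm_sub_norm_le (z - c) w]
  rw [cauchyTransform, norm_mul, hset, norm_inv, Complex.norm_real,
    Real.norm_of_nonneg Real.pi_pos.le, inv_mul_le_iff₀ Real.pi_pos]
  refine hle.trans_eq ?_
  field_simp

end CauchyTransform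

section TwistedCauchyTransform

open Set Metric Topology

variable {f m : ℂ → ℂ} {W : Set ℂ} {c z : ℂ} {ρ : ℝ}

theorem contDiff_mul_of_tsupport_subset {f χ : ℂ → ℂ} (hW : IsOpen W) (hf : ContDiffOn ℝ ∞ f W)
    (hχ : ContDiff ℝ ∞ χ) (hs : tsupport χ ⊆ W) : ContDiff ℝ ∞ (fun z => f z * χ z) := by
  refine contMDiff_iff_contDiff.1 (contMDiff_of_tsupport fun z hz => ?_)
  have hzχ : z ∈ tsupport χ := closure_mono (Function.support_mul_subset_right _ _) hz
  exact ((hf.contDiffAt (hW.mem_nhds (hs hzχ))).mul hχ.contDiffAt).contMDiffAt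

theorem contDiff_inv_mul_of_tsupport_subset (hW : IsOpen W) (hm : DifferentiableOn ℂ m W)
    (hf : ContDiff ℝ ∞ f) (hs : tsupport f ⊆ W) (hm0 : ∀ ζ ∈ tsupport f, m ζ ≠ 0) :
    ContDiff ℝ ∞ (fun ζ => (m ζ)⁻¹ * f ζ) := by
  have hV : IsOpen (W ∩ {ζ | m ζ ≠ 0}) := hm.continuousOn.isOpen_inter_preimage hW isOpen_ne
  have hinv : DifferentiableOn ℂ (fun ζ => (m ζ)⁻¹) (W ∩ {ζ | m ζ ≠ 0}) :=
    (hm.mono inter_subset_left).inv fun ζ hζ => hζ.2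
  exact contDiff_mul_of_tsupport_subset hV (contDiffOn_real_of_differentiableOn hV hinv) hf
    fun ζ hζ => ⟨hs hζ, hm0 ζ hζ⟩

/-- The Cauchy transform conjugated by multiplication with `m`. For holomorphic `m` it still solves
`v_z̄ = f`, and it is small where `m` is small compared with its values on the support of `f`. -/
noncomputable def twistedCauchyTransform (m f : ℂ → ℂ) (z : ℂ) : ℂ :=
  m z * cauchyTransform (fun ζ => (m ζ)⁻¹ * f ζ) z

theorem contDiffOn_twistedCauchyTransform (hW : IsOpen W) (hm : DifferentiableOn ℂ m W)
    (hf : ContDiff ℝ ∞ f) (hc : HasCompactSupport f) (hs : tsupport f ⊆ W)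
    (hm0 : ∀ ζ ∈ tsupport f, m ζ ≠ 0) : ContDiffOn ℝ ∞ (twistedCauchyTransform m f) W :=
  (contDiffOn_real_of_differentiableOn hW hm).mul (contDiff_cauchyTransform
    (contDiff_inv_mul_of_tsupport_subset hW hm hf hs hm0) hc.mul_left).contDiffOn

theorem dzbar_twistedCauchyTransform (hW : IsOpen W) (hm : DifferentiableOn ℂ m W)
    (hf : ContDiff ℝ ∞ f) (hc : HasCompactSupport f) (hs : tsupport f ⊆ W)
    (hm0 : ∀ ζ ∈ tsupport f, m ζ ≠ 0) (hz : z ∈ W) :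
    dzbar (twistedCauchyTransform m f) z = f z := by
  have hg := contDiff_inv_mul_of_tsupport_subset hW hm hf hs hm0
  have hdm : DifferentiableAt ℂ m z := hm.differentiableAt (hW.mem_nhds hz)
  have hprod : dzbar (twistedCauchyTransform m f) z = m z * ((m z)⁻¹ * f z) := by
    unfold twistedCauchyTransform
    rw [dzbar_mul (hdm.restrictScalars ℝ)
      ((contDiff_cauchyTransform hg hc.mul_left).differentiable (by simp) z),
      dzbar_eq_zero_of_differentiableOn hW hm hz,
      dzbar_cauchyTransform (hg.of_le (mod_cast le_top)) hc.mul_left, zero_mul, zero_add]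
  rw [hprod]
  by_cases hzf : z ∈ tsupport f
  · exact mul_inv_cancel_left₀ (hm0 z hzf) _
  · simp only [image_eq_zero_of_notMem_tsupport hzf, mul_zero]

theorem norm_twistedCauchyTransform_le {q S : ℝ} (hρ : 0 < ρ) (hsupp : tsupport f ⊆ closedBall c ρ)
    (hS : ∀ ζ, ‖f ζ‖ ≤ S) (hm0 : ∀ ζ ∈ closedBall c ρ, m ζ ≠ 0) (hzc : 2 * ρ ≤ dist z c)
    (hq : 0 ≤ q) (hmz : ∀ ζ ∈ closedBall c ρ, ‖m z‖ ≤ q * ‖m ζ‖) :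
    ‖twistedCauchyTransform m f z‖ ≤ q * (S * ρ) := by
  have hS0 : 0 ≤ S := (norm_nonneg _).trans (hS 0)
  rcases eq_or_ne (m z) 0 with hz0 | hz0
  · rw [twistedCauchyTransform, hz0, zero_mul, norm_zero]
    positivity
  have hz0' : 0 < ‖m z‖ := norm_pos_iff.2 hz0
  have hf0 (ζ : ℂ) (hζ : ζ ∉ closedBall c ρ) : (m ζ)⁻¹ * f ζ = 0 := by
    rw [image_eq_zero_of_notMem_tsupport fun h => hζ (hsupp h), mul_zero]
  have hbound (ζ : ℂ) : ‖(m ζ)⁻¹ * f ζ‖ ≤ q * S / ‖m z‖ := by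
    by_cases hζ : ζ ∈ closedBall c ρ
    · rw [norm_mul, norm_inv, inv_mul_eq_div,
        div_le_div_iff₀ (norm_pos_iff.2 (hm0 ζ hζ)) hz0', mul_right_comm, mul_comm]
      exact mul_le_mul (hmz ζ hζ) (hS ζ) (norm_nonneg _) (by positivity)
    · rw [hf0 ζ hζ, norm_zero]
      positivity
  calc ‖twistedCauchyTransform m f z‖
      ≤ ‖m z‖ * (q * S / ‖m z‖ * ρ ^ 2 / ρ) := by
        rw [twistedCauchyTransform, norm_mul]
        gcongr
        exact norm_cauchyTransform_le hρ.le hρ hf0 hbound (by linarith)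
    _ = q * (S * ρ) := by field_simp

/-- The points `z` that `m` separates from the disc of centre `c` and radius `ρ`: outside the
concentric disc of radius `2 ρ`, with `|m z|` smaller by a fixed factor than `|m|` on the disc. -/
def dampedSet (m : ℂ → ℂ) (c : ℂ) (ρ : ℝ) : Set ℂ :=
  {z | 2 * ρ ≤ dist z c ∧ ∀ ζ ∈ closedBall c ρ, ‖m z‖ ≤ 4 / 5 * ‖m ζ‖}

theorem exists_dzbar_eq_norm_le_on_dampedSet {ε : ℝ} (hW : IsOpen W) (hρ : 0 < ρ)
    (hρW : closedBall c ρ ⊆ W) (hm : DifferentiableOn ℂ m W)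
    (hm0 : ∀ ζ ∈ closedBall c ρ, m ζ ≠ 0) (hf : ContDiff ℝ ∞ f)
    (hsupp : tsupport f ⊆ closedBall c ρ) (hε : 0 < ε) :
    ∃ v : ℂ → ℂ, ContDiffOn ℝ ∞ v W ∧ (∀ z ∈ W, dzbar v z = f z) ∧
      ∀ z ∈ dampedSet m c ρ, ‖v z‖ ≤ ε := by
  have hc : HasCompactSupport f :=
    (isCompact_closedBall c ρ).of_isClosed_subset (isClosed_tsupport f) hsupp
  obtain ⟨S, hS⟩ := hc.exists_bound_of_continuous hf.continuous
  obtain ⟨N, hN⟩ : ∃ N : ℕ, (4 / 5 : ℝ) ^ N * (S * ρ) < ε := by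
    have h := (tendsto_pow_atTop_nhds_zero_of_lt_one (r := (4 / 5 : ℝ)) (by norm_num)
      (by norm_num)).mul_const (S * ρ)
    rw [zero_mul] at h
    exact (h.eventually (gt_mem_nhds hε)).exists
  have hmN (ζ : ℂ) (hζ : ζ ∈ closedBall c ρ) : m ζ ^ N ≠ 0 := pow_ne_zero N (hm0 ζ hζ)
  refine ⟨twistedCauchyTransform (fun z => m z ^ N) f,
    contDiffOn_twistedCauchyTransform hW (hm.pow N) hf hc (hsupp.trans hρW)
      fun ζ hζ => hmN ζ (hsupp hζ),
    fun z hz => dzbar_twistedCauchyTransform hW (hm.pow N) hf hc (hsupp.trans hρW)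
      (fun ζ hζ => hmN ζ (hsupp hζ)) hz,
    fun z ⟨hzc, hzm⟩ => (norm_twistedCauchyTransform_le hρ hsupp hS hmN hzc (by positivity)
      fun ζ hζ => ?_).trans hN.le⟩
  rw [norm_pow, norm_pow, ← mul_pow]
  exact pow_le_pow_left₀ (norm_nonneg _) (hzm ζ hζ) N

theorem mem_dampedSet_id (hc : 4 ≤ ‖c‖) (hz : 4 * ‖z‖ ≤ ‖c‖) : z ∈ dampedSet id c 1 := by
  refine ⟨?_, fun ζ hζ => ?_⟩
  · rw [dist_eq_norm']
    linarith [norm_sub_norm_le c z]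
  · rw [mem_closedBall, dist_eq_norm'] at hζ
    rw [id, id]
    linarith [norm_sub_norm_le c ζ]

theorem mem_dampedSet_inv_sub {p : ℂ} (hpc : dist p c ≤ 3 * ρ) (hp : p ∉ closedBall c ρ)
    (hz : 5 * ρ ≤ dist z p) : z ∈ dampedSet (fun w => (w - p)⁻¹) c ρ := by
  refine ⟨by linarith [dist_triangle_right z p c, dist_triangle z c p, dist_comm p c],
    fun ζ hζ => ?_⟩
  have hζp : 0 < dist ζ p := dist_pos.2 fun h => hp (h ▸ hζ)
  have hζρ : dist ζ p ≤ 4 * ρ := by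
    linarith [dist_triangle_right ζ p c, mem_closedBall.1 hζ]
  rw [norm_inv, norm_inv, ← dist_eq_norm, ← dist_eq_norm, ← div_eq_mul_inv,
    inv_le_comm₀ (by linarith) (by positivity), inv_div, div_le_iff₀ (by norm_num)]
  linarith

end TwistedCauchyTransform

section ExistsDzbarEq

open Set Filter Topology Metric

variable {W : Set ℂ} {c z : ℂ}

theorem exists_closedBall_subset_of_isOpen (hW : IsOpen W) (hc : c ∈ W) :
    ∃ ρ : ℝ, 0 < ρ ∧ ρ ≤ 1 ∧ closedBall c (2 * ρ) ⊆ W ∧ (ρ = 1 ∨ ∃ p ∉ W, dist p c ≤ 3 * ρ) := by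
  by_cases h : closedBall c 2 ⊆ W
  · exact ⟨1, one_pos, le_rfl, by simpa using h, Or.inl rfl⟩
  obtain ⟨x, hx, hxW⟩ := not_subset.1 h
  have hne : (Wᶜ).Nonempty := ⟨x, hxW⟩
  obtain ⟨p, hp, hpd⟩ := hW.isClosed_compl.exists_infDist_eq_dist hne c
  have hpos : 0 < infDist c Wᶜ :=
    (hW.isClosed_compl.notMem_iff_infDist_pos hne).1 (not_not.2 hc)
  have hle : infDist c Wᶜ ≤ 2 := (infDist_le_dist_of_mem hxW).trans (by rwa [dist_comm])
  refine ⟨infDist c Wᶜ / 3, by linarith, by linarith, fun y hy => ?_, Or.inr ⟨p, hp, ?_⟩⟩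
  · by_contra hyW
    have h1 : infDist c Wᶜ ≤ dist c y := infDist_le_dist_of_mem hyW
    rw [mem_closedBall, dist_comm] at hy
    linarith
  · rw [dist_comm, ← hpd]
    linarith

/- Runge's pole pushing in quantitative form: `m` is `z ↦ (z - p)⁻¹` for a point `p` of the
complement close to `c`, or `z ↦ z` when `c` is large; the points that `m` does not damp then
control the size of `c` and the distance from `c` to the complement. -/
theorem exists_damping_of_isOpen (hW : IsOpen W) (hc : c ∈ W) :
    ∃ (ρ : ℝ) (m : ℂ → ℂ), 0 < ρ ∧ ρ ≤ 1 ∧ closedBall c (2 * ρ) ⊆ W ∧ DifferentiableOn ℂ m W ∧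
      (∀ ζ ∈ closedBall c ρ, m ζ ≠ 0) ∧ ∀ (z : ℂ) (δ : ℝ), δ ≤ 1 → ball z δ ⊆ W →
        z ∈ dampedSet m c ρ ∨ (‖c‖ ≤ 4 * ‖z‖ + 8 ∧ δ ≤ 5 * ρ) := by
  obtain ⟨ρ, hρ, hρ1, hρW, rfl | ⟨p, hp, hpc⟩⟩ := exists_closedBall_subset_of_isOpen hW hc
  · rcases le_or_gt 4 ‖c‖ with hc4 | hc4
    · refine ⟨1, id, hρ, hρ1, hρW, differentiableOn_id, fun ζ hζ h0 => ?_, fun z δ hδ _ => ?_⟩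
      · obtain rfl : ζ = 0 := h0
        rw [mem_closedBall, dist_zero_left] at hζ
        linarith
      · refine (le_or_gt (4 * ‖z‖) ‖c‖).imp (mem_dampedSet_id hc4) fun h => ⟨?_, ?_⟩ <;> linarith
    · exact ⟨1, fun _ => 1, hρ, hρ1, hρW, differentiableOn_const _, fun _ _ => one_ne_zero,
        fun z δ hδ _ => Or.inr ⟨by linarith [norm_nonneg z], by linarith⟩⟩
  · have hne (z : ℂ) (hz : z ∈ W) : z - p ≠ 0 := sub_ne_zero.2 fun h => hp (h ▸ hz)
    have hρW' : closedBall c ρ ⊆ W := (closedBall_subset_closedBall (by linarith)).trans hρW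
    refine ⟨ρ, fun z => (z - p)⁻¹, hρ, hρ1, hρW, (differentiableOn_id.sub_const p).inv hne,
      fun ζ hζ => inv_ne_zero (hne ζ (hρW' hζ)), fun z δ _ hzδ => ?_⟩
    refine (le_or_gt (5 * ρ) (dist z p)).imp
      (mem_dampedSet_inv_sub hpc fun h => hp (hρW' h)) fun h => ⟨?_, ?_⟩
    · have hcz : ‖c - z‖ ≤ dist p c + dist z p := by
        rw [← dist_eq_norm, dist_comm p c, dist_comm z p]
        exact dist_triangle c p z
      linarith [norm_le_norm_add_norm_sub' c z, norm_nonneg z]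
    · by_contra! hδρ
      exact hp (hzδ (by rw [mem_ball, dist_comm]; linarith))

theorem exists_isCompact_forall_closedBall_subset_or_mem_dampedSet (hW : IsOpen W) :
    ∃ (ρ : ℂ → ℝ) (m : ℂ → ℂ → ℂ), (∀ c ∈ W, 0 < ρ c ∧ closedBall c (ρ c) ⊆ W ∧
        DifferentiableOn ℂ (m c) W ∧ ∀ ζ ∈ closedBall c (ρ c), m c ζ ≠ 0) ∧
      ∀ L ⊆ W, IsCompact L → ∃ K ⊆ W, IsCompact K ∧
        ∀ c ∈ W, ∀ z ∈ L, closedBall c (ρ c) ⊆ K ∨ z ∈ dampedSet (m c) c (ρ c) := by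
  choose! ρ m hρ hρ1 hρW hm hm0 hdamp using fun c (hc : c ∈ W) => exists_damping_of_isOpen hW hc
  refine ⟨ρ, m, fun c hc => ⟨hρ c hc, (closedBall_subset_closedBall ?_).trans (hρW c hc), hm c hc,
    hm0 c hc⟩, fun L hLW hL => ?_⟩
  · linarith [hρ c hc]
  obtain ⟨δ', hδ'0, hδ'⟩ := hL.exists_thickening_subset_open hW hLW
  obtain ⟨δ, hδ0, hδ1, hδδ'⟩ : ∃ δ : ℝ, 0 < δ ∧ δ ≤ 1 ∧ δ ≤ δ' :=
    ⟨min 1 δ', by positivity, min_le_left _ _, min_le_right _ _⟩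
  obtain ⟨R, hR⟩ := hL.isBounded.exists_norm_le
  refine ⟨closedBall 0 (4 * R + 9) \ thickening (δ / 5) Wᶜ, fun ζ hζ => ?_,
    (isCompact_closedBall _ _).diff isOpen_thickening, fun c hc z hz => ?_⟩
  · by_contra hζW
    exact hζ.2 (self_subset_thickening (by positivity) _ hζW)
  have hzW : ball z δ ⊆ W :=
    (ball_subset_ball hδδ').trans ((ball_subset_thickening hz δ').trans hδ')
  refine (hdamp c hc z δ hδ1 hzW).symm.imp_left fun ⟨hcz, hδρ⟩ ζ hζ => ⟨?_, fun hζt => ?_⟩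
  · rw [mem_closedBall_zero_iff]
    rw [mem_closedBall, dist_eq_norm] at hζ
    linarith [norm_le_norm_add_norm_sub' ζ c, hR z hz, hρ1 c hc]
  · obtain ⟨p, hp, hζp⟩ := mem_thickening_iff.1 hζt
    refine hp (hρW c hc ?_)
    rw [mem_closedBall] at hζ ⊢
    linarith [dist_triangle_left p c ζ]

theorem sum_mul_prod_one_sub {R : Type*} [CommRing R] (b : ℕ → R) (N : ℕ) :
    ∑ n ∈ Finset.range N, b n * ∏ i ∈ Finset.range n, (1 - b i) =
      1 - ∏ i ∈ Finset.range N, (1 - b i) := by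
  induction N with
  | zero => simp
  | succ N ih =>
    rw [Finset.sum_range_succ, Finset.prod_range_succ, ih]
    ring

theorem exists_seq_cover_ball {X : Type*} [PseudoMetricSpace X] [SecondCountableTopology X]
    {W : Set X} (hW : W.Nonempty) {ρ : X → ℝ} (hρ : ∀ c ∈ W, 0 < ρ c) :
    ∃ c : ℕ → X, (∀ n, c n ∈ W) ∧ W ⊆ ⋃ n, ball (c n) (ρ (c n)) := by
  obtain ⟨t, htW, htc, htcov⟩ := TopologicalSpace.countable_cover_nhdsWithin (s := W)
    (f := fun x => ball x (ρ x)) fun x hx => mem_nhdsWithin_of_mem_nhds (ball_mem_nhds x (hρ x hx))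
  have htne : t.Nonempty := by
    obtain ⟨x, hx⟩ := hW
    obtain ⟨c, hc, -⟩ := mem_iUnion₂.1 (htcov hx)
    exact ⟨c, hc⟩
  obtain ⟨c, rfl⟩ := htc.exists_eq_range htne
  exact ⟨c, fun n => htW (mem_range_self n), by simpa only [biUnion_range] using htcov⟩

theorem exists_seq_smooth_partition {E : Type*} [NormedAddCommGroup E] [NormedSpace ℝ E]
    [FiniteDimensional ℝ E] {W : Set E} (hW : W.Nonempty) {ρ : E → ℝ} (hρ : ∀ c ∈ W, 0 < ρ c) :
    ∃ (c : ℕ → E) (χ : ℕ → E → ℝ), (∀ n, c n ∈ W) ∧ (∀ n, ContDiff ℝ ∞ (χ n)) ∧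
      (∀ n, tsupport (χ n) ⊆ closedBall (c n) (ρ (c n))) ∧
      ∀ K ⊆ W, IsCompact K →
        ∃ N, ∀ z ∈ K, ∑ n ∈ Finset.range N, χ n z = 1 ∧ ∀ n ≥ N, χ n z = 0 := by
  obtain ⟨c, hcW, hcov⟩ := exists_seq_cover_ball hW fun c hc => half_pos (hρ c hc)
  let b (n : ℕ) : ContDiffBump (c n) :=
    ⟨ρ (c n) / 2, ρ (c n), half_pos (hρ _ (hcW n)), half_lt_self (hρ _ (hcW n))⟩
  refine ⟨c, fun n z => b n z * ∏ i ∈ Finset.range n, (1 - b i z), hcW,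
    fun n => (b n).contDiff.mul (contDiff_prod fun i _ => contDiff_const.sub (b i).contDiff),
    fun n => ?_, fun K hKW hK => ?_⟩
  · exact (closure_mono (Function.support_mul_subset_left _ _)).trans (b n).tsupport_eq.subset
  obtain ⟨s, hs⟩ := hK.elim_finite_subcover _ (fun _ => isOpen_ball) (hKW.trans hcov)
  obtain ⟨N, hN⟩ := s.exists_nat_subset_range
  have hprod (z : E) (hz : z ∈ K) (n : ℕ) (hn : N ≤ n) :
      ∏ i ∈ Finset.range n, (1 - b i z) = 0 := by
    obtain ⟨i, hi, hzi⟩ := mem_iUnion₂.1 (hs hz)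
    refine Finset.prod_eq_zero (Finset.range_mono hn (hN hi)) ?_
    rw [(b i).one_of_mem_closedBall (ball_subset_closedBall hzi), sub_self]
  refine ⟨N, fun z hz => ⟨?_, fun n hn => ?_⟩⟩
  · rw [sum_mul_prod_one_sub (fun n => b n z), hprod z hz N le_rfl, sub_zero]
  · simp only [hprod z hz n hn, mul_zero]

theorem exists_dzbar_eq_of_eventually_small {f : ℂ → ℂ} {v : ℕ → ℂ → ℂ} (hW : IsOpen W)
    (hv : ∀ n, ContDiffOn ℝ ∞ (v n) W)
    (hloc : ∀ L ⊆ W, IsCompact L → ∃ N : ℕ, ∀ z ∈ L,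
      ∑ n ∈ Finset.range N, dzbar (v n) z = f z ∧
      ∀ n ≥ N, dzbar (v n) z = 0 ∧ ‖v n z‖ ≤ (1 / 2) ^ n) :
    ∃ g : ℂ → ℂ, ContDiffOn ℝ ∞ g W ∧ ∀ z ∈ W, dzbar g z = f z := by
  suffices h : ∀ z ∈ W, ContDiffAt ℝ ∞ (fun w => ∑' n, v n w) z ∧
      dzbar (fun w => ∑' n, v n w) z = f z from
    ⟨_, fun z hz => (h z hz).1.contDiffWithinAt, fun z hz => (h z hz).2⟩
  intro z hz
  obtain ⟨L, hL, hzL, hLW⟩ := exists_compact_subset hW hz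
  obtain ⟨N, hN⟩ := hloc L hLW hL
  have hVW : interior L ⊆ W := interior_subset.trans hLW
  have htail (n : ℕ) (w : ℂ) (hw : w ∈ interior L) :=
    (hN w (interior_subset hw)).2 _ (N.le_add_left n)
  have hu : Summable fun n : ℕ => (1 / 2 : ℝ) ^ (n + N) :=
    (summable_nat_add_iff N).2 summable_geometric_two
  have hholo (n : ℕ) : DifferentiableOn ℂ (v (n + N)) (interior L) := fun w hw =>
    (differentiableAt_complex_iff_dzbar_eq_zero.2
      ⟨differentiableAt_of_contDiffOn hW (hv _) (hVW hw), (htail n w hw).1⟩).differentiableWithinAt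
  have hT : DifferentiableOn ℂ (fun w => ∑' n, v (n + N) w) (interior L) :=
    Complex.differentiableOn_tsum_of_summable_norm hu hholo isOpen_interior
      fun n w hw => (htail n w hw).2
  have hTz : ContDiffAt ℝ ∞ (fun w => ∑' n, v (n + N) w) z :=
    (contDiffOn_real_of_differentiableOn isOpen_interior hT).contDiffAt
      (isOpen_interior.mem_nhds hzL)
  have heq : (fun w => ∑' n, v n w) =ᶠ[𝓝 z]
      fun w => ∑ n ∈ Finset.range N, v n w + ∑' n, v (n + N) w := by
    filter_upwards [isOpen_interior.mem_nhds hzL] with w hw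
    have hs : Summable fun n => v (n + N) w :=
      Summable.of_norm_bounded hu fun n => (htail n w hw).2
    exact (((summable_nat_add_iff N).1 hs).sum_add_tsum_nat_add N).symm
  have hS : ContDiffAt ℝ ∞ (fun w => ∑ n ∈ Finset.range N, v n w) z :=
    ContDiffAt.sum fun n _ => (hv n).contDiffAt (hW.mem_nhds hz)
  refine ⟨(hS.add hTz).congr_of_eventuallyEq heq, ?_⟩
  rw [dzbar_congr heq, dzbar_add (hS.differentiableAt (by simp)) (hTz.differentiableAt (by simp)),
    dzbar_eq_zero_of_differentiableOn isOpen_interior hT hzL, add_zero,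
    dzbar_sum fun n _ => differentiableAt_of_contDiffOn hW (hv n) hz]
  exact (hN z (interior_subset hzL)).1

theorem exists_dzbar_eq {f : ℂ → ℂ} (hW : IsOpen W) (hf : ContDiffOn ℝ ∞ f W) :
    ∃ g : ℂ → ℂ, ContDiffOn ℝ ∞ g W ∧ ∀ z ∈ W, dzbar g z = f z := by
  rcases W.eq_empty_or_nonempty with rfl | hWne
  · exact ⟨0, contDiffOn_empty, fun _ => False.elim⟩
  obtain ⟨ρ, m, hρm, hcompact⟩ := exists_isCompact_forall_closedBall_subset_or_mem_dampedSet hW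
  obtain ⟨c, χ, hcW, hχ, hχs, hχsum⟩ := exists_seq_smooth_partition hWne fun c hc => (hρm c hc).1
  have hsupp (n : ℕ) : tsupport (fun z => (χ n z : ℂ)) ⊆ closedBall (c n) (ρ (c n)) :=
    (closure_mono fun z hz => Complex.ofReal_ne_zero.1 hz).trans (hχs n)
  have hv (n : ℕ) : ∃ v : ℂ → ℂ, ContDiffOn ℝ ∞ v W ∧ (∀ z ∈ W, dzbar v z = f z * χ n z) ∧
      ∀ z, z ∈ dampedSet (m (c n)) (c n) (ρ (c n)) ∨ χ n = 0 → ‖v z‖ ≤ (1 / 2) ^ n := by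
    by_cases h0 : χ n = 0
    · exact ⟨0, contDiffOn_const, fun z _ => by simp [h0, dzbar], fun z _ => by simp⟩
    obtain ⟨hρ, hρW, hm, hm0⟩ := hρm _ (hcW n)
    obtain ⟨v, hvs, hvf, hvE⟩ := exists_dzbar_eq_norm_le_on_dampedSet hW hρ hρW hm hm0
      (contDiff_mul_of_tsupport_subset hW hf (Complex.ofRealCLM.contDiff.comp (hχ n))
        ((hsupp n).trans hρW))
      ((closure_mono (Function.support_mul_subset_right _ _)).trans (hsupp n))
      (ε := (1 / 2) ^ n) (by positivity)
    exact ⟨v, hvs, hvf, fun z hz => hvE z (hz.resolve_right h0)⟩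
  choose v hvs hvf hvsmall using hv
  refine exists_dzbar_eq_of_eventually_small hW hvs fun L hLW hL => ?_
  obtain ⟨K, hKW, hK, hKL⟩ := hcompact L hLW hL
  obtain ⟨N, hN⟩ := hχsum (K ∪ L) (union_subset hKW hLW) (hK.union hL)
  refine ⟨N, fun z hz => ⟨?_, fun n hn => ⟨?_, hvsmall n z ?_⟩⟩⟩
  · simp only [hvf _ z (hLW hz), ← Finset.mul_sum, ← Complex.ofReal_sum, (hN z (.inr hz)).1,
      Complex.ofReal_one, mul_one]
  · rw [hvf n z (hLW hz), (hN z (.inr hz)).2 n hn, Complex.ofReal_zero, mul_zero]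
  · refine (hKL (c n) (hcW n) z hz).symm.imp_right fun hball => funext fun ζ => ?_
    by_cases hζ : ζ ∈ closedBall (c n) (ρ (c n))
    · exact (hN ζ (.inl (hball hζ))).2 n hn
    · exact image_eq_zero_of_notMem_tsupport fun h => hζ (hχs n h)

end ExistsDzbarEq

section Quaternions

open scoped ComplexOrder

/-- Left multiplication by the unit `j` on the quaternions `ℍ = ℂ²`. For `b = (ψ₁, ψ̄₂)` the Dirac
equation takes the form `b_z̄ = Ū j b`. -/
noncomputable def quatJ (b : Fin 2 → ℂ) : Fin 2 → ℂ := ![conj (b 1), -conj (b 0)]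

/-- The derivative `∂/∂z̄` of a vector-valued function, taken componentwise. -/
noncomputable def dzbarVec {ι : Type*} (v : ℂ → ι → ℂ) (z : ℂ) : ι → ℂ :=
  fun i => dzbar (fun w => v w i) z

variable {ι : Type*} {b : ℂ → Fin 2 → ℂ} {χ χ' ψ ψ' : ℂ → Fin 2 → ℂ} {l U U' : ℂ → ℂ} {z : ℂ}
  {W : Set ℂ}

theorem quatJ_smul (l : ℂ) (b : Fin 2 → ℂ) : quatJ (l • b) = conj l • quatJ b := by
  ext i
  fin_cases i <;> simp [quatJ]

theorem smul_add_smul_quatJ_eq_iff {b : Fin 2 → ℂ} (hb : b ≠ 0) {s t s' t' : ℂ} :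
    s • b + t • quatJ b = s' • b + t' • quatJ b ↔ s = s' ∧ t = t' := by
  refine ⟨fun h => ?_, by rintro ⟨rfl, rfl⟩; rfl⟩
  have h0 := congrFun h 0
  have h1 := congrFun h 1
  simp only [quatJ, Pi.add_apply, Pi.smul_apply, smul_eq_mul, Matrix.cons_val_zero,
    Matrix.cons_val_one] at h0 h1
  have hb' : b 0 * conj (b 0) + b 1 * conj (b 1) ≠ 0 := by
    simpa [dotProduct, Fin.sum_univ_two] using mt dotProduct_self_star_eq_zero.1 hb
  constructor
  · refine mul_right_cancel₀ hb' ?_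
    linear_combination conj (b 0) * h0 + conj (b 1) * h1
  · refine mul_right_cancel₀ hb' ?_
    linear_combination b 1 * h0 - b 0 * h1

theorem dzbarVec_congr {v w : ℂ → ι → ℂ} (h : v =ᶠ[nhds z] w) : dzbarVec v z = dzbarVec w z :=
  funext fun i => dzbar_congr (h.mono fun _ hx => congrFun hx i)

theorem dzbarVec_smul {v : ℂ → ι → ℂ} (hl : DifferentiableAt ℝ l z)
    (hv : ∀ i, DifferentiableAt ℝ (fun w => v w i) z) :
    dzbarVec (fun w => l w • v w) z = dzbar l z • v z + l z • dzbarVec v z :=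
  funext fun i => dzbar_mul hl (hv i)

theorem dzbarVec_smul_eq_smul_quatJ_iff {α β V : ℂ}
    (hdb : dzbarVec b z = α • b z + β • quatJ (b z)) (hb0 : b z ≠ 0)
    (hl : DifferentiableAt ℝ l z) (hb : ∀ i, DifferentiableAt ℝ (fun w => b w i) z) :
    dzbarVec (fun w => l w • b w) z = V • quatJ (l z • b z) ↔
      dzbar l z + l z * α = 0 ∧ l z * β = V * conj (l z) := by
  have hleft : dzbarVec (fun w => l w • b w) z =
      (dzbar l z + l z * α) • b z + (l z * β) • quatJ (b z) := by
    rw [dzbarVec_smul hl hb, hdb]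
    module
  have hright : V • quatJ (l z • b z) = (0 : ℂ) • b z + (V * conj (l z)) • quatJ (b z) := by
    rw [quatJ_smul]
    module
  rw [hleft, hright, smul_add_smul_quatJ_eq_iff hb0]

theorem contDiffOn_of_contDiffOn_smul {E : Type*} [NormedAddCommGroup E] [NormedSpace ℝ E]
    [Fintype ι] {n : WithTop ℕ∞} {s : Set E} {l : E → ℂ} {b : E → ι → ℂ}
    (hb : ContDiffOn ℝ n b s) (hlb : ContDiffOn ℝ n (fun x => l x • b x) s)
    (hb0 : ∀ x ∈ s, b x ≠ 0) : ContDiffOn ℝ n l s := by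
  have hdot {v : E → ι → ℂ} (hv : ContDiffOn ℝ n v s) :
      ContDiffOn ℝ n (fun x => v x ⬝ᵥ star (b x)) s :=
    ContDiffOn.sum fun i _ => (contDiffOn_pi.1 hv i).mul
      (Complex.conjCLE.contDiff.comp_contDiffOn (contDiffOn_pi.1 hb i))
  have hne : ∀ x ∈ s, b x ⬝ᵥ star (b x) ≠ 0 := fun x hx =>
    mt dotProduct_self_star_eq_zero.1 (hb0 x hx)
  refine ((hdot hlb).mul ((hdot hb).inv hne)).congr fun x hx => ?_
  rw [Pi.inv_apply, smul_dotProduct, smul_eq_mul, mul_inv_cancel_right₀ (hne x hx)]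

theorem halfConj_involutive : Function.Involutive halfConj := fun χ => by
  ext i
  fin_cases i <;> simp [halfConj]

theorem contDiffOn_halfConj (hχ : ContDiffOn ℝ ∞ χ W) :
    ContDiffOn ℝ ∞ (fun z => halfConj (χ z)) W := by
  refine contDiffOn_pi.2 fun i => ?_
  fin_cases i
  · exact contDiffOn_pi.1 hχ 0
  · exact Complex.conjCLE.contDiff.comp_contDiffOn (contDiffOn_pi.1 hχ 1)

theorem contDiffOn_of_contDiffOn_halfConj (hχ : ContDiffOn ℝ ∞ (fun z => halfConj (χ z)) W) :
    ContDiffOn ℝ ∞ χ W := by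
  simpa only [halfConj_involutive _] using contDiffOn_halfConj hχ

theorem dirac_eq_zero_iff : dirac U ψ z = 0 ↔
    dzbarVec (fun w => halfConj (ψ w)) z = conj (U z) • quatJ (halfConj (ψ z)) := by
  have h0 : -dzbar (fun w => ψ w 0) z + conj (U z) * ψ z 1 = 0 ↔
      dzbar (fun w => ψ w 0) z = conj (U z) * ψ z 1 := by
    rw [neg_add_eq_zero]
  have h1 : dz (fun w => ψ w 1) z + U z * ψ z 0 = 0 ↔
      conj (dz (fun w => ψ w 1) z) = -(conj (U z) * conj (ψ z 0)) := by
    rw [add_eq_zero_iff_eq_neg, ← map_mul, ← map_neg, (starRingEnd ℂ).injective.eq_iff]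
  simp [dirac, funext_iff, Fin.forall_fin_two, dzbarVec, halfConj, quatJ, dzbar_conj, h0, h1,
    and_comm]

theorem diracDual_eq_dirac : diracDual U ψ z = dirac (fun w => conj (U w)) ψ z := by
  simp only [diracDual, dirac, Complex.conj_conj]

theorem dirac_eq_zero_iff_of_halfConj_eq_smul (hW : IsOpen W) (hz : z ∈ W)
    (hψ : ContDiffOn ℝ ∞ ψ W) (hψ0 : halfConj (ψ z) ≠ 0) (hl : ContDiffOn ℝ ∞ l W)
    (hψ' : ∀ w ∈ W, halfConj (ψ' w) = l w • halfConj (ψ w)) (hD : dirac U ψ z = 0) :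
    dirac U' ψ' z = 0 ↔ dzbar l z = 0 ∧ U' z * l z = conj (l z) * U z := by
  have hconj : l z * conj (U z) = conj (U' z) * conj (l z) ↔ U' z * l z = conj (l z) * U z := by
    rw [← (starRingEnd ℂ).injective.eq_iff, eq_comm]
    simp only [map_mul, Complex.conj_conj]
  have hdb : dzbarVec (fun w => halfConj (ψ w)) z =
      (0 : ℂ) • halfConj (ψ z) + conj (U z) • quatJ (halfConj (ψ z)) := by
    rw [dirac_eq_zero_iff.1 hD, zero_smul, zero_add]
  have hb i : DifferentiableAt ℝ (fun w => halfConj (ψ w) i) z :=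
    differentiableAt_of_contDiffOn hW (contDiffOn_pi.1 (contDiffOn_halfConj hψ) i) hz
  rw [dirac_eq_zero_iff, dzbarVec_congr (Filter.eventually_of_mem (hW.mem_nhds hz) hψ'), hψ' z hz,
    dzbarVec_smul_eq_smul_quatJ_iff hdb hψ0 (differentiableAt_of_contDiffOn hW hl hz) hb,
    mul_zero, add_zero, hconj]

end Quaternions

section Segre

open scoped ComplexOrder

variable {W : Set ℂ} {z : ℂ} {r : ℂ → EuclideanSpace ℝ (Fin 4)}

theorem segreVec_sub_left (a a' b : Fin 2 → ℂ) :
    segreVec (a - a') b = segreVec a b - segreVec a' b := by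
  ext i
  fin_cases i <;> simp [segreVec] <;> ring

theorem segreVec_smul_left (s : ℂ) (a b : Fin 2 → ℂ) :
    segreVec (s • a) b = s • segreVec a b := by
  ext i
  fin_cases i <;> simp [segreVec] <;> ring

theorem segreVec_smul_right (s : ℂ) (a b : Fin 2 → ℂ) :
    segreVec a (s • b) = s • segreVec a b := by
  ext i
  fin_cases i <;> simp [segreVec] <;> ring

theorem segreVec_left_cancel {a a' b : Fin 2 → ℂ} (hb : b ≠ 0)
    (h : segreVec a b = segreVec a' b) : a = a' := by
  by_contra hne
  refine segreVec_ne_zero (sub_ne_zero.2 hne) hb ?_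
  rw [segreVec_sub_left, h, sub_self]

theorem segreVec_dotProduct_self (a b : Fin 2 → ℂ) : segreVec a b ⬝ᵥ segreVec a b = 0 := by
  simp only [dotProduct, segreVec, Fin.sum_univ_four, Matrix.cons_val]
  linear_combination (a 0 * a 1 * b 0 * b 1 + (a 1 * b 1 - a 0 * b 0) ^ 2 / 4 +
    (a 1 * b 0 - a 0 * b 1) ^ 2 / 4) * Complex.I_sq

theorem star_segreVec_quatJ_left (a b : Fin 2 → ℂ) :
    star (segreVec (quatJ a) b) = segreVec a (quatJ b) := by
  ext i
  fin_cases i <;> simp [segreVec, quatJ] <;> ring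

theorem eq_zero_of_star_segreVec_eq_self {a b : Fin 2 → ℂ} (hb : b ≠ 0)
    (h : star (segreVec a b) = segreVec a b) : a = 0 := by
  have h0 : segreVec a b = 0 :=
    dotProduct_star_self_eq_zero.1 (by rw [h, segreVec_dotProduct_self])
  by_contra ha
  exact segreVec_ne_zero ha hb h0

theorem dzbarVec_segreVec {a b : ℂ → Fin 2 → ℂ}
    (ha : ∀ i, DifferentiableAt ℝ (fun w => a w i) z)
    (hb : ∀ i, DifferentiableAt ℝ (fun w => b w i) z) :
    dzbarVec (fun w => segreVec (a w) (b w)) z =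
      segreVec (dzbarVec a z) (b z) + segreVec (a z) (dzbarVec b z) := by
  have hab i j : DifferentiableAt ℝ (fun w => a w i * b w j) z := (ha i).mul (hb j)
  refine funext fun i => ?_
  fin_cases i <;>
    simp only [dzbarVec, segreVec, Fin.zero_eta, Fin.mk_one, Fin.reduceFinMk, Pi.add_apply,
      Matrix.cons_val]
  · rw [dzbar_const_mul _ ((hab 1 1).fun_add (hab 0 0)), dzbar_add (hab 1 1) (hab 0 0),
      dzbar_mul (ha 1) (hb 1), dzbar_mul (ha 0) (hb 0)]
    ring
  · rw [dzbar_const_mul _ ((hab 1 1).fun_sub (hab 0 0)), dzbar_sub (hab 1 1) (hab 0 0),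
      dzbar_mul (ha 1) (hb 1), dzbar_mul (ha 0) (hb 0)]
    ring
  · rw [dzbar_const_mul _ ((hab 1 0).fun_add (hab 0 1)), dzbar_add (hab 1 0) (hab 0 1),
      dzbar_mul (ha 1) (hb 0), dzbar_mul (ha 0) (hb 1)]
    ring
  · rw [dzbar_const_mul _ ((hab 1 0).fun_sub (hab 0 1)), dzbar_sub (hab 1 0) (hab 0 1),
      dzbar_mul (ha 1) (hb 0), dzbar_mul (ha 0) (hb 1)]
    ring

theorem apply_zero_smul_eq_segreVec (a b : Fin 2 → ℂ) :
    a 0 • b = ![-Complex.I * segreVec a b 0 - segreVec a b 1,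
      segreVec a b 2 + Complex.I * segreVec a b 3] := by
  refine funext (Fin.forall_fin_two.2 ⟨?_, ?_⟩) <;>
    simp only [segreVec, Pi.smul_apply, smul_eq_mul, Matrix.cons_val]
  · linear_combination (a 1 * b 1 + a 0 * b 0) / 2 * Complex.I_sq
  · linear_combination -(a 1 * b 0 - a 0 * b 1) / 2 * Complex.I_sq

theorem apply_one_smul_eq_segreVec (a b : Fin 2 → ℂ) :
    a 1 • b = ![segreVec a b 2 - Complex.I * segreVec a b 3,
      -Complex.I * segreVec a b 0 + segreVec a b 1] := by
  refine funext (Fin.forall_fin_two.2 ⟨?_, ?_⟩) <;>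
    simp only [segreVec, Pi.smul_apply, smul_eq_mul, Matrix.cons_val]
  · linear_combination (a 1 * b 0 - a 0 * b 1) / 2 * Complex.I_sq
  · linear_combination (a 1 * b 1 + a 0 * b 0) / 2 * Complex.I_sq

theorem contDiffOn_of_contDiffOn_segreVec {E : Type*} [NormedAddCommGroup E] [NormedSpace ℝ E]
    {n : WithTop ℕ∞} {s : Set E} {a b : E → Fin 2 → ℂ} (hb : ContDiffOn ℝ n b s)
    (hab : ContDiffOn ℝ n (fun x => segreVec (a x) (b x)) s) (hb0 : ∀ x ∈ s, b x ≠ 0) :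
    ContDiffOn ℝ n a s := by
  have hS (i : Fin 4) := contDiffOn_pi.1 hab i
  have hIS (i : Fin 4) := (contDiffOn_const (c := Complex.I)).mul (hS i)
  refine contDiffOn_pi.2 (Fin.forall_fin_two.2 ⟨?_, ?_⟩) <;>
    refine contDiffOn_of_contDiffOn_smul hb ?_ hb0 <;>
    simp only [apply_zero_smul_eq_segreVec, apply_one_smul_eq_segreVec, neg_mul] <;>
    refine contDiffOn_pi.2 (Fin.forall_fin_two.2 ⟨?_, ?_⟩)
  · exact (hIS 0).neg.sub (hS 1)
  · exact (hS 2).add (hIS 3)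
  · exact (hS 2).sub (hIS 3)
  · exact (hIS 0).neg.add (hS 1)

theorem contDiffOn_apply_of_euclidean (hr : ContDiffOn ℝ ∞ r W) (k : Fin 4) :
    ContDiffOn ℝ ∞ (fun w => r w k) W :=
  (EuclideanSpace.proj k : EuclideanSpace ℝ (Fin 4) →L[ℝ] ℝ).contDiff.comp_contDiffOn hr

theorem contDiffOn_rz (hW : IsOpen W) (hr : ContDiffOn ℝ ∞ r W) : ContDiffOn ℝ ∞ (rz r) W :=
  contDiffOn_pi.2 fun k => contDiffOn_dz hW
    (Complex.ofRealCLM.contDiff.comp_contDiffOn (contDiffOn_apply_of_euclidean hr k))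

theorem star_dzbarVec_rz (hW : IsOpen W) (hr : ContDiffOn ℝ ∞ r W) (hz : z ∈ W) :
    star (dzbarVec (rz r) z) = dzbarVec (rz r) z :=
  funext fun k => conj_dzbar_dz_ofReal
    (contDiffAt_infty.1 ((contDiffOn_apply_of_euclidean hr k).contDiffAt (hW.mem_nhds hz)) 2)

theorem WeierstrassFormula.eqOn {ψ φ φ' : ℂ → Fin 2 → ℂ} (h : WeierstrassFormula r W ψ φ)
    (h' : WeierstrassFormula r W ψ φ') (hψ : ∀ z ∈ W, halfConj (ψ z) ≠ 0) : Set.EqOn φ φ' W :=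
  fun z hz => halfConj_involutive.injective
    (segreVec_left_cancel (hψ z hz) ((h z hz).symm.trans (h' z hz)))

theorem WeierstrassFormula.contDiffOn (hW : IsOpen W) (hr : ContDiffOn ℝ ∞ r W)
    {ψ φ : ℂ → Fin 2 → ℂ} (h : WeierstrassFormula r W ψ φ) (hψ : ContDiffOn ℝ ∞ ψ W)
    (hψ0 : ∀ z ∈ W, halfConj (ψ z) ≠ 0) : ContDiffOn ℝ ∞ φ W :=
  contDiffOn_of_contDiffOn_halfConj <| contDiffOn_of_contDiffOn_segreVec
    (contDiffOn_halfConj hψ) ((contDiffOn_rz hW hr).congr fun z hz => (h z hz).symm) hψ0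

/- With `a`, `b` for the vectors of `φ`, `ψ` and `c = a_z̄ - U j a`, the derivative `r_zz̄` is
`S(c, b) + X + X̄` for `X = U S(j a, b)`. As `r_zz̄` is real, so is `S(c, b)`, and a real vector on
the quadric vanishes. -/
theorem WeierstrassFormula.diracDual_eq_zero (hW : IsOpen W) (hr : ContDiffOn ℝ ∞ r W)
    {ψ φ : ℂ → Fin 2 → ℂ} {U : ℂ → ℂ} (h : WeierstrassFormula r W ψ φ)
    (hψ : ContDiffOn ℝ ∞ ψ W) (hφ : ContDiffOn ℝ ∞ φ W) (hz : z ∈ W) (hψ0 : halfConj (ψ z) ≠ 0)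
    (hD : dirac U ψ z = 0) : diracDual U φ z = 0 := by
  rw [diracDual_eq_dirac, dirac_eq_zero_iff, Complex.conj_conj]
  rw [dirac_eq_zero_iff] at hD
  have hd {χ : ℂ → Fin 2 → ℂ} (hχ : ContDiffOn ℝ ∞ χ W) (i : Fin 2) :
      DifferentiableAt ℝ (fun w => halfConj (χ w) i) z :=
    differentiableAt_of_contDiffOn hW (contDiffOn_pi.1 (contDiffOn_halfConj hχ) i) hz
  have hdr : dzbarVec (rz r) z = segreVec (dzbarVec (fun w => halfConj (φ w)) z) (halfConj (ψ z)) +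
      segreVec (halfConj (φ z)) (dzbarVec (fun w => halfConj (ψ w)) z) := by
    rw [dzbarVec_congr (Filter.eventually_of_mem (hW.mem_nhds hz) h),
      dzbarVec_segreVec (hd hφ) (hd hψ)]
  have hreal := star_dzbarVec_rz hW hr hz
  rw [hdr, hD, segreVec_smul_right, ← star_segreVec_quatJ_left] at hreal
  refine sub_eq_zero.1 (eq_zero_of_star_segreVec_eq_self hψ0 ?_)
  rw [segreVec_sub_left, segreVec_smul_left]
  simp only [star_add, star_sub, star_smul, star_star, Complex.star_def, Complex.conj_conj]
    at hreal ⊢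
  linear_combination hreal

theorem exists_rz_eq_segreVec {hr : IsConformalImmersionOn r W}
    {Gψ Gφ : W → Projectivization ℂ (Fin 2 → ℂ)} (hG : AreGaussComponents hr Gψ Gφ) (z : W)
    {b : Fin 2 → ℂ} (hb : b ≠ 0) (hbG : Gψ z = Projectivization.mk ℂ b hb) :
    ∃ (a : Fin 2 → ℂ) (ha : a ≠ 0), rz r z = segreVec a b ∧
      Gφ z = Projectivization.mk ℂ a ha := by
  have h := hG z
  rw [hbG, ← (Gφ z).mk_rep, segre_mk _ _ (Gφ z).rep_nonzero hb, gaussMap, eq_comm,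
    Projectivization.mk_eq_mk_iff'] at h
  obtain ⟨t, ht⟩ := h
  have ht0 : t ≠ 0 := by
    rintro rfl
    exact hr.rz_ne_zero z.2 (by rw [← ht, zero_smul])
  refine ⟨t • (Gφ z).rep, smul_ne_zero ht0 (Gφ z).rep_nonzero,
    by rw [segreVec_smul_left, ht], ?_⟩
  conv_lhs => rw [← (Gφ z).mk_rep]
  exact (Projectivization.mk_eq_mk_iff' ..).2 ⟨t⁻¹, inv_smul_smul₀ ht0 _⟩

theorem exists_weierstrassFormula {hr : IsConformalImmersionOn r W}
    {Gψ Gφ : W → Projectivization ℂ (Fin 2 → ℂ)} (hG : AreGaussComponents hr Gψ Gφ)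
    {ψ : ℂ → Fin 2 → ℂ} (hψ : Represents ψ Gψ) :
    ∃ φ, WeierstrassFormula r W ψ φ ∧ Represents φ Gφ := by
  have hpt (z : W) := exists_rz_eq_segreVec hG z (hψ z).1 (hψ z).2
  choose a ha0 ha hGa using hpt
  obtain ⟨φ, hφ⟩ : ∃ φ : ℂ → Fin 2 → ℂ, ∀ z : W, halfConj (φ z) = a z :=
    ⟨Function.extend Subtype.val (fun z => halfConj (a z)) 0, fun z => by
      rw [Subtype.val_injective.extend_apply, halfConj_involutive]⟩
  refine ⟨φ, fun z hz => ?_, fun z => ?_⟩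
  · rw [hφ ⟨z, hz⟩, ha ⟨z, hz⟩]
  · simp only [hφ]
    exact ⟨ha0 z, hGa z⟩

theorem exists_isDiracLift {hr : IsConformalImmersionOn r W}
    {Gψ Gφ : W → Projectivization ℂ (Fin 2 → ℂ)} (hG : AreGaussComponents hr Gψ Gφ)
    {ψ : ℂ → Fin 2 → ℂ} {U : ℂ → ℂ} (hψ : ContDiffOn ℝ ∞ ψ W) (hrep : Represents ψ Gψ)
    (hD : ∀ z ∈ W, dirac U ψ z = 0) : ∃ φ, IsDiracLift r Gψ Gφ ψ φ U := by
  have hψ0 : ∀ z ∈ W, halfConj (ψ z) ≠ 0 := fun z hz => (hrep ⟨z, hz⟩).1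
  obtain ⟨φ, hw, hφG⟩ := exists_weierstrassFormula hG hrep
  have hφ := hw.contDiffOn hr.isOpen hr.smooth hψ hψ0
  exact ⟨φ, hψ, hφ, hrep, hφG, hw, hD, fun z hz =>
    hw.diracDual_eq_zero hr.isOpen hr.smooth hψ hφ hz (hψ0 z hz) (hD z hz)⟩

end Segre

section Gauge

variable {W : Set ℂ} {r : ℂ → EuclideanSpace ℝ (Fin 4)}
  {G Gψ Gφ : W → Projectivization ℂ (Fin 2 → ℂ)} {χ χ' ψ φ ψ' φ' : ℂ → Fin 2 → ℂ}
  {h l U U' : ℂ → ℂ}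

theorem Represents.of_smul (hχ : Represents χ G) (hl : ∀ z ∈ W, l z ≠ 0)
    (hχ' : ∀ z ∈ W, halfConj (χ' z) = l z • halfConj (χ z)) : Represents χ' G := by
  intro z
  obtain ⟨h0, hz⟩ := hχ z
  refine ⟨hχ' z z.2 ▸ smul_ne_zero (hl z z.2) h0, ?_⟩
  rw [hz, Projectivization.mk_eq_mk_iff']
  exact ⟨(l z)⁻¹, by rw [hχ' z z.2, inv_smul_smul₀ (hl z z.2)]⟩

theorem Represents.exists_smul (hχ : Represents χ G) (hχ' : Represents χ' G) :
    ∃ l : ℂ → ℂ, ∀ z ∈ W, l z ≠ 0 ∧ halfConj (χ' z) = l z • halfConj (χ z) := by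
  have hpt (z : ℂ) : ∃ t : ℂ, z ∈ W → t ≠ 0 ∧ halfConj (χ' z) = t • halfConj (χ z) := by
    by_cases hz : z ∈ W
    · obtain ⟨h0, e⟩ := hχ ⟨z, hz⟩
      obtain ⟨h0', e'⟩ := hχ' ⟨z, hz⟩
      obtain ⟨t, ht⟩ := (Projectivization.mk_eq_mk_iff ..).1 (e'.symm.trans e)
      exact ⟨t, fun _ => ⟨t.ne_zero, ht.symm⟩⟩
    · exact ⟨0, fun hz' => absurd hz' hz⟩
  exact ⟨fun z => (hpt z).choose, fun z => (hpt z).choose_spec⟩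

theorem halfConj_eq_exp_smul_iff {h : ℂ} {χ χ' : Fin 2 → ℂ} :
    halfConj χ' = Complex.exp h • halfConj χ ↔
      χ' = ![Complex.exp h * χ 0, Complex.exp (conj h) * χ 1] := by
  rw [← halfConj_involutive.injective.eq_iff (b := ![_, _])]
  simp [halfConj, ← Complex.exp_conj]

theorem gaugeRelated_iff_halfConj : GaugeRelated W h ψ φ U ψ' φ' U' ↔ ∀ z ∈ W,
    halfConj (ψ' z) = Complex.exp (h z) • halfConj (ψ z) ∧
    halfConj (φ' z) = Complex.exp (-h z) • halfConj (φ z) ∧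
    U' z = Complex.exp (conj (h z) - h z) * U z := by
  simp only [GaugeRelated, halfConj_eq_exp_smul_iff, map_neg]

theorem eq_exp_sub_mul_iff {u u' a b : ℂ} :
    u' = Complex.exp (a - b) * u ↔ u' * Complex.exp b = Complex.exp a * u := by
  rw [Complex.exp_sub, div_mul_eq_mul_div, eq_div_iff (Complex.exp_ne_zero b)]

theorem Represents.exp_smul (hχ : Represents χ G)
    (hχ' : ∀ z ∈ W, halfConj (χ' z) = Complex.exp (h z) • halfConj (χ z)) : Represents χ' G :=
  hχ.of_smul (fun z _ => Complex.exp_ne_zero (h z)) hχ'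

theorem contDiffOn_of_halfConj_eq_exp_smul (hχ : ContDiffOn ℝ ∞ χ W) (hh : ContDiffOn ℝ ∞ h W)
    (hχ' : ∀ z ∈ W, halfConj (χ' z) = Complex.exp (h z) • halfConj (χ z)) :
    ContDiffOn ℝ ∞ χ' W :=
  contDiffOn_of_contDiffOn_halfConj ((hh.cexp.smul (contDiffOn_halfConj hχ)).congr hχ')

theorem dirac_eq_zero_of_halfConj_eq_exp_smul (hW : IsOpen W) (hh : DifferentiableOn ℂ h W)
    (hχ : ContDiffOn ℝ ∞ χ W) (hG : Represents χ G)
    (hχ' : ∀ z ∈ W, halfConj (χ' z) = Complex.exp (h z) • halfConj (χ z))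
    (hU' : ∀ z ∈ W, U' z = Complex.exp (conj (h z) - h z) * U z) {z : ℂ} (hz : z ∈ W)
    (hD : dirac U χ z = 0) : dirac U' χ' z = 0 := by
  refine (dirac_eq_zero_iff_of_halfConj_eq_smul hW hz hχ (hG ⟨z, hz⟩).1
    (contDiffOn_real_of_differentiableOn hW hh.cexp) hχ' hD).2
    ⟨dzbar_eq_zero_of_differentiableOn hW hh.cexp hz, ?_⟩
  rw [← Complex.exp_conj]
  exact eq_exp_sub_mul_iff.1 (hU' z hz)

theorem IsDiracLift.gauge (hW : IsOpen W) (hL : IsDiracLift r Gψ Gφ ψ φ U)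
    (hh : DifferentiableOn ℂ h W) (hg : GaugeRelated W h ψ φ U ψ' φ' U') :
    IsDiracLift r Gψ Gφ ψ' φ' U' := by
  rw [gaugeRelated_iff_halfConj] at hg
  have hψ' := fun z hz => (hg z hz).1
  have hφ' := fun z hz => (hg z hz).2.1
  have hU' := fun z hz => (hg z hz).2.2
  have hUc : ∀ z ∈ W, conj (U' z) = Complex.exp (conj (-h z) - -h z) * conj (U z) := by
    intro z hz
    rw [hU' z hz, map_mul, ← Complex.exp_conj, map_sub, Complex.conj_conj, map_neg]
    ring_nf
  have hhs := contDiffOn_real_of_differentiableOn hW hh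
  refine ⟨contDiffOn_of_halfConj_eq_exp_smul hL.smooth_psi hhs hψ',
    contDiffOn_of_halfConj_eq_exp_smul hL.smooth_phi hhs.neg hφ', hL.represents_psi.exp_smul hψ',
    hL.represents_phi.exp_smul hφ', fun z hz => ?_, fun z hz =>
    dirac_eq_zero_of_halfConj_eq_exp_smul hW hh hL.smooth_psi hL.represents_psi hψ' hU' hz
      (hL.dirac_psi z hz), fun z hz => ?_⟩
  · rw [hψ' z hz, hφ' z hz, segreVec_smul_left, segreVec_smul_right, smul_smul,
      ← Complex.exp_add, neg_add_cancel, Complex.exp_zero, one_smul, hL.weierstrass z hz]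
  · have hD := hL.dirac_phi z hz
    rw [diracDual_eq_dirac] at hD ⊢
    exact dirac_eq_zero_of_halfConj_eq_exp_smul hW hh.neg hL.smooth_phi hL.represents_phi hφ' hUc
      hz hD

theorem WeierstrassFormula.halfConj_eq_inv_smul (hw : WeierstrassFormula r W ψ φ)
    (hw' : WeierstrassFormula r W ψ' φ') {z : ℂ} (hz : z ∈ W) (hψ0 : halfConj (ψ z) ≠ 0)
    {l : ℂ} (hl : l ≠ 0) (hψ' : halfConj (ψ' z) = l • halfConj (ψ z)) :
    halfConj (φ' z) = l⁻¹ • halfConj (φ z) := by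
  have h := hw' z hz
  rw [hψ', segreVec_smul_right, ← segreVec_smul_left, hw z hz] at h
  rw [segreVec_left_cancel hψ0 h, inv_smul_smul₀ hl]

theorem IsDiracLift.gaugeRelated (hW : IsOpen W) (hL : IsDiracLift r Gψ Gφ ψ φ U)
    (hL' : IsDiracLift r Gψ Gφ ψ' φ' U') (hh : ContinuousOn h W)
    (hψ' : ∀ z ∈ W, halfConj (ψ' z) = Complex.exp (h z) • halfConj (ψ z)) :
    DifferentiableOn ℂ h W ∧ GaugeRelated W h ψ φ U ψ' φ' U' := by
  have hψ0 : ∀ z ∈ W, halfConj (ψ z) ≠ 0 := fun z hz => (hL.represents_psi ⟨z, hz⟩).1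
  have hexp : ContDiffOn ℝ ∞ (fun z => Complex.exp (h z)) W :=
    contDiffOn_of_contDiffOn_smul (contDiffOn_halfConj hL.smooth_psi)
      ((contDiffOn_halfConj hL'.smooth_psi).congr fun z hz => (hψ' z hz).symm) hψ0
  have hD z (hz : z ∈ W) := (dirac_eq_zero_iff_of_halfConj_eq_smul hW hz hL.smooth_psi (hψ0 z hz)
    hexp hψ' (hL.dirac_psi z hz)).1 (hL'.dirac_psi z hz)
  have hhol z (hz : z ∈ W) : DifferentiableAt ℂ h z :=
    have hexp' : DifferentiableAt ℂ (fun w => Complex.exp (h w)) z :=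
      differentiableAt_complex_iff_dzbar_eq_zero.2
        ⟨differentiableAt_of_contDiffOn hW hexp hz, (hD z hz).1⟩
    (HasDerivAt.of_comp_left (hh.continuousAt (hW.mem_nhds hz)) (Complex.hasDerivAt_exp _)
      hexp'.hasDerivAt (Complex.exp_ne_zero _) Filter.EventuallyEq.rfl).differentiableAt
  refine ⟨fun z hz => (hhol z hz).differentiableWithinAt,
    gaugeRelated_iff_halfConj.2 fun z hz => ⟨hψ' z hz, ?_, ?_⟩⟩
  · rw [Complex.exp_neg]
    exact hL.weierstrass.halfConj_eq_inv_smul hL'.weierstrass hz (hψ0 z hz)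
      (Complex.exp_ne_zero _) (hψ' z hz)
  · rw [eq_exp_sub_mul_iff, Complex.exp_conj]
    exact (hD z hz).2

theorem IsDiracLift.exists_gaugeRelated (hW : IsOpen W) (hsc : IsSimplyConnected W)
    (hL : IsDiracLift r Gψ Gφ ψ φ U) (hL' : IsDiracLift r Gψ Gφ ψ' φ' U') :
    ∃ h : ℂ → ℂ, DifferentiableOn ℂ h W ∧ GaugeRelated W h ψ φ U ψ' φ' U' := by
  obtain ⟨l, hl⟩ := hL.represents_psi.exists_smul hL'.represents_psi
  have hls : ContDiffOn ℝ ∞ l W :=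
    contDiffOn_of_contDiffOn_smul (contDiffOn_halfConj hL.smooth_psi)
      ((contDiffOn_halfConj hL'.smooth_psi).congr fun z hz => (hl z hz).2.symm)
      fun z hz => (hL.represents_psi ⟨z, hz⟩).1
  obtain ⟨h, hh, hexp⟩ := Complex.exists_continuousOn_eqOn_exp_comp hsc hW hls.continuousOn
    fun ⟨z, hz, h0⟩ => (hl z hz).1 h0
  exact ⟨h, hL.gaugeRelated hW hL' hh fun z hz => (hl z hz).2.trans (by rw [← hexp hz]; rfl)⟩

end Gauge

section Spherical

variable {W : Set ℂ} {θ η : ℂ → ℝ} {g g' U : ℂ → ℂ} {z : ℂ}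

theorem halfConj_liftOf (θ η : ℂ → ℝ) (g : ℂ → ℂ) (z : ℂ) :
    halfConj (liftOf θ η g z) = Complex.exp (g z) • sphericalVec (θ z) (η z) := by
  refine funext (Fin.forall_fin_two.2 ⟨?_, ?_⟩)
  · simp [halfConj, liftOf, sphericalVec, Complex.exp_add, mul_assoc]
  · simp [halfConj, liftOf, sphericalVec, ← Complex.exp_conj, -Complex.ofReal_sin]

theorem halfConj_liftOf_eq_exp_sub_smul (θ η : ℂ → ℝ) (g g' : ℂ → ℂ) (z : ℂ) :
    halfConj (liftOf θ η g' z) = Complex.exp (g' z - g z) • halfConj (liftOf θ η g z) := by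
  rw [halfConj_liftOf, halfConj_liftOf, smul_smul, ← Complex.exp_add, sub_add_cancel]

theorem represents_liftOf {G : W → Projectivization ℂ (Fin 2 → ℂ)}
    (hG : ∀ z : W, G z = sphericalPoint (θ z) (η z)) (g : ℂ → ℂ) :
    Represents (liftOf θ η g) G := by
  refine Represents.exp_smul (χ := fun z => halfConj (sphericalVec (θ z) (η z))) (fun z => ?_)
    fun z _ => (halfConj_liftOf θ η g z).trans (by rw [halfConj_involutive])
  simp only [halfConj_involutive _]
  exact ⟨sphericalVec_ne_zero _ _, hG z⟩

theorem potentialOf_add (θ η : ℂ → ℝ) (g h : ℂ → ℂ) (z : ℂ) :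
    potentialOf θ η (fun w => g w + h w) z =
      Complex.exp (conj (h z) - h z) * potentialOf θ η g z := by
  rw [potentialOf, potentialOf, map_add, show conj (g z) + conj (h z) - (g z + h z) -
    Complex.I * θ z = (conj (h z) - h z) + (conj (g z) - g z - Complex.I * θ z) by ring,
    Complex.exp_add]
  ring

theorem contDiffOn_potentialOf (hW : IsOpen W) (hθ : ContDiffOn ℝ ∞ θ W)
    (hη : ContDiffOn ℝ ∞ η W) (hg : ContDiffOn ℝ ∞ g W) :
    ContDiffOn ℝ ∞ (potentialOf θ η g) W := by
  have hcast {x : ℂ → ℝ} (hx : ContDiffOn ℝ ∞ x W) : ContDiffOn ℝ ∞ (fun w => (x w : ℂ)) W :=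
    Complex.ofRealCLM.contDiff.comp_contDiffOn hx
  have hgc : ContDiffOn ℝ ∞ (fun w => conj (g w)) W :=
    Complex.conjCLE.contDiff.comp_contDiffOn hg
  exact ((hgc.sub hg).sub (contDiffOn_const.mul (hcast hθ))).cexp.neg.mul
    ((((contDiffOn_const.mul (contDiffOn_dz hW (hcast hθ))).mul (hcast hη.sin)).mul
      (hcast hη.cos)).add (contDiffOn_dz hW (hcast hη)))

theorem dzbarVec_sphericalVec (hθ : DifferentiableAt ℝ θ z) (hη : DifferentiableAt ℝ η z) :
    dzbarVec (fun w => sphericalVec (θ w) (η w)) z =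
      (Complex.I * dzbar (fun w => (θ w : ℂ)) z * Real.cos (η z) ^ 2) • sphericalVec (θ z) (η z) +
      (Complex.exp (Complex.I * θ z) * (Complex.I * dzbar (fun w => (θ w : ℂ)) z *
        Real.sin (η z) * Real.cos (η z) - dzbar (fun w => (η w : ℂ)) z)) •
        quatJ (sphericalVec (θ z) (η z)) := by
  have hθc : DifferentiableAt ℝ (fun w => (θ w : ℂ)) z :=
    Complex.ofRealCLM.differentiableAt.comp z hθ
  have hηc : DifferentiableAt ℝ (fun w => (η w : ℂ)) z :=
    Complex.ofRealCLM.differentiableAt.comp z hη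
  have hIθ := hθc.const_mul Complex.I
  have hcos : DifferentiableAt ℝ (fun w => Complex.cos (η w)) z :=
    ((Complex.differentiable_cos _).restrictScalars ℝ).comp z hηc
  have hsc : Complex.sin (η z) ^ 2 + Complex.cos (η z) ^ 2 = 1 := Complex.sin_sq_add_cos_sq _
  have hunit : Complex.exp (Complex.I * θ z) * conj (Complex.exp (Complex.I * θ z)) = 1 := by
    rw [← Complex.exp_conj, ← Complex.exp_add, map_mul, Complex.conj_I, Complex.conj_ofReal,
      neg_mul, add_neg_cancel, Complex.exp_zero]
  refine funext (Fin.forall_fin_two.2 ⟨?_, ?_⟩) <;>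
    simp only [dzbarVec, sphericalVec, quatJ, Pi.add_apply, Pi.smul_apply, smul_eq_mul,
      Matrix.cons_val, map_mul, Complex.conj_ofReal] <;>
    push_cast
  · rw [dzbar_mul hIθ.cexp hcos, dzbar_comp (Complex.hasDerivAt_exp _) hIθ,
      dzbar_comp (Complex.hasDerivAt_cos _) hηc, dzbar_const_mul _ hθc]
    linear_combination -(Complex.exp (Complex.I * θ z) * Complex.I *
      dzbar (fun w => (θ w : ℂ)) z * Complex.cos (η z)) * hsc
  · rw [dzbar_comp (Complex.hasDerivAt_sin _) hηc]
    linear_combination (Complex.I * dzbar (fun w => (θ w : ℂ)) z * Complex.sin (η z) *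
      Complex.cos (η z) ^ 2 - Complex.cos (η z) * dzbar (fun w => (η w : ℂ)) z) * hunit

theorem dirac_liftOf_eq_zero_iff (hθ : DifferentiableAt ℝ θ z) (hη : DifferentiableAt ℝ η z)
    (hg : DifferentiableAt ℝ g z) : dirac U (liftOf θ η g) z = 0 ↔
      dzbar g z = -Complex.I * dzbar (fun w => (θ w : ℂ)) z * (Real.cos (η z) : ℂ) ^ 2 ∧
        U z = potentialOf θ η g z := by
  have hs (i : Fin 2) : DifferentiableAt ℝ (fun w => sphericalVec (θ w) (η w) i) z := by
    fin_cases i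
    · exact ((Complex.ofRealCLM.differentiableAt.comp z hθ).const_mul Complex.I).cexp.mul
        (Complex.ofRealCLM.differentiableAt.comp z hη.cos)
    · exact Complex.ofRealCLM.differentiableAt.comp z hη.sin
  have hpot : potentialOf θ η g z = Complex.exp (conj (g z) - g z) *
      conj (Complex.exp (Complex.I * θ z) * (Complex.I * dzbar (fun w => (θ w : ℂ)) z *
        Real.sin (η z) * Real.cos (η z) - dzbar (fun w => (η w : ℂ)) z)) := by
    simp only [potentialOf, map_mul, map_sub, ← Complex.exp_conj, Complex.conj_I,
      Complex.conj_ofReal, ← conj_dz_ofReal, Complex.conj_conj]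
    rw [sub_eq_add_neg _ (Complex.I * _), Complex.exp_add]
    ring_nf
  rw [dirac_eq_zero_iff, halfConj_liftOf, funext (halfConj_liftOf θ η g),
    dzbarVec_smul_eq_smul_quatJ_iff (dzbarVec_sphericalVec hθ hη) (sphericalVec_ne_zero _ _)
      hg.cexp hs, dzbar_comp (Complex.hasDerivAt_exp _) hg, ← mul_add,
    mul_eq_zero_iff_left (Complex.exp_ne_zero _)]
  refine and_congr (by rw [add_eq_zero_iff_eq_neg]; ring_nf) ?_
  rw [hpot, eq_exp_sub_mul_iff, ← (starRingEnd ℂ).injective.eq_iff, eq_comm, map_mul, map_mul,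
    Complex.conj_conj, Complex.conj_conj, Complex.exp_conj]

theorem forall_dirac_liftOf_eq_zero_iff (hW : IsOpen W) (hθ : ContDiffOn ℝ ∞ θ W)
    (hη : ContDiffOn ℝ ∞ η W) (hg : ContDiffOn ℝ ∞ g W) :
    (∀ z ∈ W, dirac U (liftOf θ η g) z = 0) ↔
      SolvesDbar W θ η g ∧ Set.EqOn U (potentialOf θ η g) W := by
  have hd {F : Type} [NormedAddCommGroup F] [NormedSpace ℝ F] {f : ℂ → F} {z : ℂ}
      (hf : ContDiffOn ℝ ∞ f W) (hz : z ∈ W) := differentiableAt_of_contDiffOn hW hf hz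
  have h z (hz : z ∈ W) := dirac_liftOf_eq_zero_iff (U := U) (hd hθ hz) (hd hη hz) (hd hg hz)
  exact (forall₂_congr h).trans forall₂_and

theorem SolvesDbar.iff_differentiableOn_sub (hW : IsOpen W) (hg : ContDiffOn ℝ ∞ g W)
    (hg' : ContDiffOn ℝ ∞ g' W) (hs : SolvesDbar W θ η g) :
    SolvesDbar W θ η g' ↔ DifferentiableOn ℂ (fun z => g' z - g z) W := by
  have hd {z} (hz : z ∈ W) := differentiableAt_of_contDiffOn hW hg hz
  have hd' {z} (hz : z ∈ W) := differentiableAt_of_contDiffOn hW hg' hz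
  have hdiff : SolvesDbar W θ η g' ↔ ∀ z ∈ W, dzbar (fun w => g' w - g w) z = 0 :=
    forall₂_congr fun z hz => by rw [dzbar_sub (hd' hz) (hd hz), sub_eq_zero, hs z hz]
  rw [hdiff]
  exact ⟨fun h z hz => (differentiableAt_complex_iff_dzbar_eq_zero.2
      ⟨(hd' hz).fun_sub (hd hz), h z hz⟩).differentiableWithinAt,
    fun h z hz => dzbar_eq_zero_of_differentiableOn hW h hz⟩

theorem exists_solvesDbar (hW : IsOpen W) (hθ : ContDiffOn ℝ ∞ θ W) (hη : ContDiffOn ℝ ∞ η W) :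
    ∃ g, ContDiffOn ℝ ∞ g W ∧ SolvesDbar W θ η g :=
  exists_dzbar_eq hW ((contDiffOn_const.mul (contDiffOn_dzbar hW
    (Complex.ofRealCLM.contDiff.comp_contDiffOn hθ))).mul
      ((Complex.ofRealCLM.contDiff.comp_contDiffOn hη.cos).pow 2))

end Spherical

end SurfaceR4

theorem mainTheorem1 {W : Set ℂ} {r : ℂ → EuclideanSpace ℝ (Fin 4)}
    (hr : IsConformalImmersionOn r W)
    (Gψ Gφ : W → Projectivization ℂ (Fin 2 → ℂ)) (hG : AreGaussComponents hr Gψ Gφ) :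
    -- the component `Gψ` in spherical coordinates
    (∀ θ η : ℂ → ℝ, ContDiffOn ℝ ∞ θ W → ContDiffOn ℝ ∞ η W →
      (∀ z : W, Gψ z = sphericalPoint (θ z) (η z)) →
      -- existence of a representative of `Gψ` satisfying the Dirac equation
      (∃ g : ℂ → ℂ, ContDiffOn ℝ ∞ g W ∧ SolvesDbar W θ η g ∧ Represents (liftOf θ η g) Gψ ∧
        ContDiffOn ℝ ∞ (potentialOf θ η g) W ∧
        ∀ z ∈ W, dirac (potentialOf θ η g) (liftOf θ η g) z = 0) ∧
      -- the equation for `g` and the formula for the potential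
      (∀ g U : ℂ → ℂ, ContDiffOn ℝ ∞ g W →
        ((∀ z ∈ W, dirac U (liftOf θ η g) z = 0) ↔
          SolvesDbar W θ η g ∧ Set.EqOn U (potentialOf θ η g) W)) ∧
      -- `g` is defined up to holomorphic functions `h`, and `U` up to the factors `e^{h̄ - h}`
      (∀ g g' : ℂ → ℂ, ContDiffOn ℝ ∞ g W → ContDiffOn ℝ ∞ g' W → SolvesDbar W θ η g →
        (SolvesDbar W θ η g' ↔ DifferentiableOn ℂ (fun z => g' z - g z) W)) ∧
      (∀ g h : ℂ → ℂ, ∀ z ∈ W, potentialOf θ η (fun w => g w + h w) z =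
        Complex.exp (conj (h z) - h z) * potentialOf θ η g z) ∧
      -- lifts with `ψ = (e^{g+iθ} cos η, e^{ḡ} sin η)` are related by gauge transformations
      (∀ (g g' : ℂ → ℂ) (φ φ' : ℂ → Fin 2 → ℂ) (U U' : ℂ → ℂ),
        ContDiffOn ℝ ∞ g W → ContDiffOn ℝ ∞ g' W →
        IsDiracLift r Gψ Gφ (liftOf θ η g) φ U → IsDiracLift r Gψ Gφ (liftOf θ η g') φ' U' →
        ∃ h : ℂ → ℂ, DifferentiableOn ℂ h W ∧
          GaugeRelated W h (liftOf θ η g) φ U (liftOf θ η g') φ' U')) ∧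
    -- `ψ` determines `φ`, which represents `Gφ` and satisfies the dual Dirac equation
    (∀ (ψ : ℂ → Fin 2 → ℂ) (U : ℂ → ℂ), ContDiffOn ℝ ∞ ψ W → Represents ψ Gψ →
      (∀ z ∈ W, dirac U ψ z = 0) →
      ∃ φ : ℂ → Fin 2 → ℂ, IsDiracLift r Gψ Gφ ψ φ U ∧
        ∀ φ' : ℂ → Fin 2 → ℂ, WeierstrassFormula r W ψ φ' → Set.EqOn φ' φ W) ∧
    -- gauge transformations with holomorphic `h` take lifts to lifts
    (∀ (ψ φ : ℂ → Fin 2 → ℂ) (U h : ℂ → ℂ) (ψ' φ' : ℂ → Fin 2 → ℂ) (U' : ℂ → ℂ),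
      IsDiracLift r Gψ Gφ ψ φ U → DifferentiableOn ℂ h W →
      GaugeRelated W h ψ φ U ψ' φ' U' → IsDiracLift r Gψ Gφ ψ' φ' U') ∧
    -- over a simply connected `W` any two lifts are related by such a transformation
    (IsSimplyConnected W →
      ∀ (ψ φ : ℂ → Fin 2 → ℂ) (U : ℂ → ℂ) (ψ' φ' : ℂ → Fin 2 → ℂ) (U' : ℂ → ℂ),
        IsDiracLift r Gψ Gφ ψ φ U → IsDiracLift r Gψ Gφ ψ' φ' U' →
        ∃ h : ℂ → ℂ, DifferentiableOn ℂ h W ∧ GaugeRelated W h ψ φ U ψ' φ' U') := by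
  have hW := hr.isOpen
  refine ⟨fun θ η hθ hη hsph => ⟨?_, fun g U hg => forall_dirac_liftOf_eq_zero_iff hW hθ hη hg,
    fun g g' hg hg' hs => hs.iff_differentiableOn_sub hW hg hg',
    fun g h z _ => potentialOf_add θ η g h z, fun g g' φ φ' U U' hg hg' hL hL' => ?_⟩,
    fun ψ U hψ hrep hD => ?_, fun ψ φ U h ψ' φ' U' hL hh hgauge => hL.gauge hW hh hgauge,
    fun hsc ψ φ U ψ' φ' U' hL hL' => hL.exists_gaugeRelated hW hsc hL'⟩
  · obtain ⟨g, hg, hs⟩ := exists_solvesDbar hW hθ hη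
    exact ⟨g, hg, hs, represents_liftOf hsph g, contDiffOn_potentialOf hW hθ hη hg,
      (forall_dirac_liftOf_eq_zero_iff hW hθ hη hg).2 ⟨hs, Set.eqOn_refl _ _⟩⟩
  · exact ⟨fun z => g' z - g z, hL.gaugeRelated hW hL' (hg'.sub hg).continuousOn
      fun z _ => halfConj_liftOf_eq_exp_sub_smul θ η g g' z⟩
  · obtain ⟨φ, hL⟩ := exists_isDiracLift hG hψ hrep hD
    exact ⟨φ, hL, fun φ' hφ' =>
      hφ'.eqOn hL.weierstrass fun z hz => (hrep ⟨z, hz⟩).1⟩
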